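/- **Theorem (HAC covariance estimation for non-stationary random fields).** *Random field.* Let $e_i^{(j)}$, $i,j\in\mathbf Z$, be independent (not necessarily identically distributed) real random variables, and for $1\le i\le n$, $1\le j\le m$ let $\epsilon_i^{(j)}=G_{i,n}^{(j),m}(e_{i-u}^{(j-v)};\,u,v\in\mathbf Z)$ with measurable functions $G_{i,n}^{(j),m}$ (so $\epsilon_i^{(j)}$ may depend on $n,m$). Let $e_i^{(j)\dagger}$, $i,j\in\mathbf Z$, be an independent copy of the family $(e_i^{(j)})$, and let $\epsilon_{i,p}^{(j),(q)}$ be obtained from $\epsilon_i^{(j)}$ by replacing $e_{i+p}^{(j+q)}$ with $e_{i+p}^{(j+q)\dagger}$. With $\Vert X\Vert_M=(\mathbf E|X|^M)^{1/M}$ put $\delta_p^{(q)}=\max_{1\le i\le n,\,1\le j\le m}\Vert\epsilon_i^{(j)}-\epsilon_{i,p}^{(j),(q)}\Vert_M$. The field is called $(M,\alpha)$-short range dependent if $\mathbf E\epsilon_i^{(j)}=0$ for all $i,j$, $\max_{i,j}\Vert\epsilon_i^{(j)}\Vert_M=O(1)$ and $\sup_{p,q\in\mathbf Z}(1+|p|+|q|)^\alpha\delta_p^{(q)}=O(1)$.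 All limits and $O(\cdot)$ are as $\min(n,m)\to\infty$. *Kernel.* A variance kernel is a function $K:\mathbf R\to[0,1]$ that is symmetric, continuously differentiable, decreasing on $[0,\infty)$, with $K(0)=1$, $\int_{\mathbf R}K(t)e^{-2\pi \mathrm i tx}\,dt\ge 0$ for all $x\in\mathbf R$, $\int_0^\infty K^2(x)\,dx<\infty$ and $\int_0^\infty xK(x)\,dx<\infty$. *Coefficients.* Let $\mathcal K=\mathcal K(n,m)$ be positive integers with $\mathcal K\to\infty$, $\mathcal K/n\to0$, $\mathcal K/m\to0$, and let $V=V(n,m)\ge 1$ be integers. For $v=1,\dots,V$ let $a_{i,v}^{(j)}$ ($1\le i\le n$, $1\le j\le m$) be real numbers (which may depend on $n,m$) such that, for a fixed constant $C>0$, there are integers $x_v\in[\mathcal K+1,n-\mathcal K]$, $y_v\in[\mathcal K+1,m-\mathcal K]$ and reals $\lambda_{i,v},\tau_{j,v}\ge0$ with $$\sum_{i=1}^n\sum_{j=1}^m a_{i,v}^{(j)2}>0,\qquad a_{i,v}^{(j)}=0\ \text{ if } |i-x_v|>\mathcal K\text{ or }|j-y_v|>\mathcal K,\qquad |c_{i,v}^{(j)}|\le\lambda_{i,v}\tau_{j,v},$$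 $$\sum_{i=1}^n\lambda_{i,v}^2\le C,\qquad \sum_{j=1}^m\tau_{j,v}^2\le C,\qquad \lambda_{i,v}\le C/\sqrt{\mathcal K},\qquad \tau_{j,v}\le C/\sqrt{\mathcal K},$$ where $c_{i,v}^{(j)}=a_{i,v}^{(j)}\big/\sqrt{\sum_{i=1}^n\sum_{j=1}^m a_{i,v}^{(j)2}}$. *Claim.* Suppose $M>4$, $\alpha>5$, the field $\epsilon_i^{(j)}$ is $(M,\alpha)$-short range dependent, $K$ is a variance kernel, and the real bandwidth $\mathcal B=\mathcal B(n,m)$ satisfies $\mathcal B\to\infty$ and $V^{4/M}\mathcal B^3/\mathcal K\to0$. Then $$\Big\Vert\max_{1\le v_1,v_2\le V}\Big|\sum_{i_1=1}^n\sum_{j_1=1}^m\sum_{i_2=1}^n\sum_{j_2=1}^m c_{i_1,v_1}^{(j_1)}c_{i_2,v_2}^{(j_2)}\epsilon_{i_1}^{(j_1)}\epsilon_{i_2}^{(j_2)}K\Big(\tfrac{i_1-i_2}{\mathcal B}\Big)K\Big(\tfrac{j_1-j_2}{\mathcal B}\Big)-\mathrm{Cov}\Big(\sum_{i=1}^n\sum_{j=1}^m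 c_{i,v_1}^{(j)}\epsilon_i^{(j)},\ \sum_{i=1}^n\sum_{j=1}^m c_{i,v_2}^{(j)}\epsilon_i^{(j)}\Big)\Big|\Big\Vert_{M/2}=O\Big(S(\mathcal B)+\frac{V^{4/M}\mathcal B^3}{\mathcal K}\Big),$$ where $S(\mathcal B)=\mathcal B^{5-\alpha}$ if $5<\alpha<6$, $S(\mathcal B)=\log(\mathcal B)/\mathcal B$ if $\alpha=6$, and $S(\mathcal B)=1/\mathcal B$ if $\alpha>6$. -/

import Mathlib

open MeasureTheory ProbabilityTheory Filter
open scoped ENNReal NNReal FourierTransform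

namespace HAC

noncomputable section

variable {Ω : Type*} [MeasurableSpace Ω]

/-- The innovations seen from site `(i, j)`, evaluated at `ω`: `(u, v) ↦ e_{i-u}^{(j-v)}(ω)`. -/
def shifted (e : ℤ × ℤ → Ω → ℝ) (i j : ℤ) (ω : Ω) : ℤ × ℤ → ℝ :=
  fun u => e (i - u.1, j - u.2) ω

/-- The innovations seen from site `(i, j)` after the innovation at site `(i + p, j + q)` has been
replaced by an independent copy. A point of `Ω × Ω` (with the measure `P.prod P`) carries the
original innovations `e_k(z.1)` and the independent copies `e_k†(z) = e_k(z.2)`. -/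
def shiftedReplaced (e : ℤ × ℤ → Ω → ℝ) (i j p q : ℤ) (z : Ω × Ω) : ℤ × ℤ → ℝ :=
  fun u => if i - u.1 = i + p ∧ j - u.2 = j + q then e (i - u.1, j - u.2) z.2
    else e (i - u.1, j - u.2) z.1

/-- The dependence measure at one site,
`‖ε_i^{(j)} - ε_{i,p}^{(j),(q)}‖_M`, where `ε_i^{(j)} = g (e_{i-u}^{(j-v)} ; u, v ∈ ℤ)`. -/
def siteDependence (P : Measure Ω) (M : ℝ) (e : ℤ × ℤ → Ω → ℝ) (g : (ℤ × ℤ → ℝ) → ℝ)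
    (i j p q : ℤ) : ℝ≥0∞ :=
  eLpNorm (fun z : Ω × Ω => g (shifted e i j z.1) - g (shiftedReplaced e i j p q z))
    (ENNReal.ofReal M) (P.prod P)

/-- The dependence measure `δ_p^{(q)}`, the maximum of the site measures over
`1 ≤ i ≤ n`, `1 ≤ j ≤ m`. -/
def dependence (P : Measure Ω) (M : ℝ) (e : ℤ × ℤ → Ω → ℝ)
    (G : ℤ → ℤ → (ℤ × ℤ → ℝ) → ℝ) (n m : ℕ) (p q : ℤ) : ℝ≥0∞ :=
  ⨆ i ∈ Finset.Icc (1 : ℤ) n, ⨆ j ∈ Finset.Icc (1 : ℤ) m, siteDependence P M e (G i j) i j p q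

/-- The array `ε n m i j`, `1 ≤ i ≤ n`, `1 ≤ j ≤ m`, is a (location and sample size dependent)
measurable transformation `G n m i j` of independent innovations `e`, is centred, has bounded
`M`-th moments, and has polynomially decaying dependence measures. The bounds `O(1)` are
understood as `min (n, m) → ∞`. -/
structure IsShortRangeDependentVia (P : Measure Ω) (M α : ℝ) (ε : ℕ → ℕ → ℤ → ℤ → Ω → ℝ)
    (e : ℤ × ℤ → Ω → ℝ) (G : ℕ → ℕ → ℤ → ℤ → (ℤ × ℤ → ℝ) → ℝ) : Prop where
  measurable_innovation : ∀ k, Measurable (e k)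
  indep_innovation : iIndepFun e P
  measurable_transform : ∀ n m : ℕ, ∀ i ∈ Finset.Icc (1 : ℤ) n, ∀ j ∈ Finset.Icc (1 : ℤ) m,
    Measurable (G n m i j)
  eq_transform : ∀ n m : ℕ, ∀ i ∈ Finset.Icc (1 : ℤ) n, ∀ j ∈ Finset.Icc (1 : ℤ) m,
    ∀ ω, ε n m i j ω = G n m i j (shifted e i j ω)
  centred : ∀ n m : ℕ, ∀ i ∈ Finset.Icc (1 : ℤ) n, ∀ j ∈ Finset.Icc (1 : ℤ) m,
    ∫ ω, ε n m i j ω ∂P = 0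
  moment_bound : ∃ C : ℝ≥0, ∀ᶠ s : ℕ × ℕ in atTop,
    ⨆ i ∈ Finset.Icc (1 : ℤ) s.1, ⨆ j ∈ Finset.Icc (1 : ℤ) s.2,
      eLpNorm (ε s.1 s.2 i j) (ENNReal.ofReal M) P ≤ C
  dependence_bound : ∃ C : ℝ≥0, ∀ᶠ s : ℕ × ℕ in atTop,
    ⨆ p : ℤ, ⨆ q : ℤ, ENNReal.ofReal ((1 + |(p : ℝ)| + |(q : ℝ)|) ^ α) *
      dependence P M e (G s.1 s.2) s.1 s.2 p q ≤ C

/-- `(M, α)`-short range dependent random fields. -/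
def IsShortRangeDependent (P : Measure Ω) (M α : ℝ) (ε : ℕ → ℕ → ℤ → ℤ → Ω → ℝ) : Prop :=
  ∃ (e : ℤ × ℤ → Ω → ℝ) (G : ℕ → ℕ → ℤ → ℤ → (ℤ × ℤ → ℝ) → ℝ),
    IsShortRangeDependentVia P M α ε e G

/-- `√(∑_{i=1}^n ∑_{j=1}^m (a_i^{(j)})²)`. -/
def l2norm (n m : ℕ) (a : ℤ → ℤ → ℝ) : ℝ :=
  √(∑ i ∈ Finset.Icc (1 : ℤ) n, ∑ j ∈ Finset.Icc (1 : ℤ) m, a i j ^ 2)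

/-- The normalized coefficients `c_i^{(j)} = a_i^{(j)} / √(∑_{i=1}^n ∑_{j=1}^m (a_i^{(j)})²)`. -/
def normalized (n m : ℕ) (a : ℤ → ℤ → ℝ) (i j : ℤ) : ℝ := a i j / l2norm n m a

/-- The conditions, with constant `C` and window size `κ`, on the coefficients `a` of one linear
form: they are not all zero, vanish outside a window of half-width `κ` that is centred at an
interior point `(x, y)`, and are spread out over that window. -/
def IsAdmissibleCoefficient (C : ℝ) (n m κ : ℕ) (a : ℤ → ℤ → ℝ) : Prop :=
  (0 < ∑ i ∈ Finset.Icc (1 : ℤ) n, ∑ j ∈ Finset.Icc (1 : ℤ) m, a i j ^ 2) ∧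
  (∃ x y : ℤ, (κ : ℤ) + 1 ≤ x ∧ x ≤ (n : ℤ) - κ ∧ (κ : ℤ) + 1 ≤ y ∧ y ≤ (m : ℤ) - κ ∧
    ∀ i ∈ Finset.Icc (1 : ℤ) n, ∀ j ∈ Finset.Icc (1 : ℤ) m,
      ((κ : ℤ) < |i - x| ∨ (κ : ℤ) < |j - y|) → a i j = 0) ∧
  (∃ lam tau : ℤ → ℝ,
    (∀ i ∈ Finset.Icc (1 : ℤ) n, 0 ≤ lam i ∧ lam i ≤ C / √(κ : ℝ)) ∧
    (∀ j ∈ Finset.Icc (1 : ℤ) m, 0 ≤ tau j ∧ tau j ≤ C / √(κ : ℝ)) ∧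
    (∑ i ∈ Finset.Icc (1 : ℤ) n, lam i ^ 2 ≤ C) ∧
    (∑ j ∈ Finset.Icc (1 : ℤ) m, tau j ^ 2 ≤ C) ∧
    ∀ i ∈ Finset.Icc (1 : ℤ) n, ∀ j ∈ Finset.Icc (1 : ℤ) m,
      |a i j| / l2norm n m a ≤ lam i * tau j)

/-- Variance kernel functions. -/
structure IsVarianceKernel (K : ℝ → ℝ) : Prop where
  mem_unit : ∀ x, K x ∈ Set.Icc (0 : ℝ) 1
  symm : ∀ x, K (-x) = K x
  contDiff : ContDiff ℝ 1 K
  map_zero : K 0 = 1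
  antitone : AntitoneOn K (Set.Ici 0)
  fourier_nonneg : ∀ x : ℝ, 0 ≤ (𝓕 (fun t : ℝ => (K t : ℂ)) x).re ∧
    (𝓕 (fun t : ℝ => (K t : ℂ)) x).im = 0
  integrable_sq : IntegrableOn (fun x => K x ^ 2) (Set.Ioi 0)
  integrable_mul : IntegrableOn (fun x => x * K x) (Set.Ioi 0)

/-- The linear form `∑_{i=1}^n ∑_{j=1}^m c_i^{(j)} ε_i^{(j)}`. -/
def linearForm (n m : ℕ) (c : ℤ → ℤ → ℝ) (ε : ℤ → ℤ → Ω → ℝ) (ω : Ω) : ℝ :=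
  ∑ i ∈ Finset.Icc (1 : ℤ) n, ∑ j ∈ Finset.Icc (1 : ℤ) m, c i j * ε i j ω

/-- The kernel-weighted quadratic estimator of the covariance of the linear forms with
coefficients `c` and `d`, with kernel `K` and bandwidth `b`. -/
def hacEstimator (K : ℝ → ℝ) (b : ℝ) (n m : ℕ) (c d : ℤ → ℤ → ℝ) (ε : ℤ → ℤ → Ω → ℝ)
    (ω : Ω) : ℝ :=
  ∑ i₁ ∈ Finset.Icc (1 : ℤ) n, ∑ j₁ ∈ Finset.Icc (1 : ℤ) m,
    ∑ i₂ ∈ Finset.Icc (1 : ℤ) n, ∑ j₂ ∈ Finset.Icc (1 : ℤ) m,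
      c i₁ j₁ * d i₂ j₂ * ε i₁ j₁ ω * ε i₂ j₂ ω *
        K (((i₁ : ℝ) - i₂) / b) * K (((j₁ : ℝ) - j₂) / b)

/-- The bias rate `S(b)`. -/
def biasRate (α b : ℝ) : ℝ :=
  if α < 6 then b ^ (5 - α) else if α = 6 then Real.log b / b else 1 / b

end

end HAC

/-!
The innovations are independent, so every site of the field is a functional of a point of the
product space `ℤ × ℤ → ℝ` with a product measure, and the dependence measure `δ_p^{(q)}` bounds the
*influence* of one coordinate: the `Lᵖ` size of the change when that coordinate is replaced by an
independent copy (`siteDependence_eq_influence`).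

Two general inequalities for functionals of independent variables carry the proof. Revealing the
coordinates one after the other gives a martingale whose increments are bounded by the influences
(`eLpNorm_partialMean_sub_le`), because averaging out coordinates computes conditional expectations
(`partialMean_ae_eq_condExp`) and exchanging coordinates between two independent copies does not
change their joint law (`map_exchange`).
* The two-smoothness of `Lᵖ` norms, `p ≥ 2`, bounds the squared norm of a martingale by a constant
  times the sum of the squared norms of its increments (`lpNorm_add_sq_le`). With Lévy's upward
  theorem and Fatou's lemma this becomes an Efron–Stein inequality in `Lᵖ`
  (`eLpNorm_sub_integral_le`).
* The orthogonality of the increments bounds a covariance by the sum of the products of the `L²`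
  influences (`abs_integral_mul_sub_le`).

The estimator minus the covariance splits into a centred quadratic form and a bias.

The influence of the innovation at `r` on the quadratic form is, by Hölder's inequality in
`L^{M/2}`, at most `max |c| * (row sums of the kernel)` times the convolutions of `|c_{v₁}|` and
`|c_{v₂}|` with the summable weights which bound `δ`. As `max |c| = O(1 / 𝒦)`, as the row sums are
`O(ℬ³)`, and as Young's inequality bounds the square sum over `r` of the convolutions, each centred
quadratic form is `O(ℬ³ / 𝒦)` in `L^{M/2}` (`eLpNorm_quadratic_sub_integral_le`). The maximum over
`V²` pairs costs the factor `(V²)^{2/M} = V^{4/M}` (`eLpNorm_iSup_abs_le`).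

For the bias (`abs_integral_quadratic_sub_le`), `|K K - 1| ≤ L |lag| / ℬ`. By the triangle
inequality the factor `|lag|` is absorbed by the weights of the covariance inequality, which decay fast enough
to remain summable after the loss of one power. The bias is thus `O(1 / ℬ)`, and `1 / ℬ` is
eventually at most the rate `S(ℬ)` for every `α > 5` (`one_div_le_biasRate`).
-/

namespace HAC

/-! ### Two-smoothness of `Lᵖ` norms: the scalar inequalities -/

/-- Lipschitz bound for `x ↦ x ^ r` on `[0, ∞)`, in the form given by Bernoulli's inequality. -/
lemma rpow_sub_rpow_le {r a b : ℝ} (hr : 1 ≤ r) (hb : 0 ≤ b) (hab : b ≤ a) :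
    a ^ r - b ^ r ≤ r * a ^ (r - 1) * (a - b) := by
  rcases (hb.trans hab).eq_or_lt with ha | ha
  · have : b = 0 := le_antisymm (ha ▸ hab) hb
    simp [← ha, this]
  have h1 : b ^ r = a ^ r * (1 + (b / a - 1)) ^ r := by
    rw [← Real.mul_rpow ha.le (by simp; positivity)]
    congr 1
    field_simp
    ring
  have h2 := one_add_mul_self_le_rpow_one_add (s := b / a - 1) (by
    have : 0 ≤ b / a := by positivity
    linarith) hr
  have h3 : a ^ r = a ^ (r - 1) * a := by
    rw [← Real.rpow_add_one ha.ne']; simp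
  have h4 : a ^ r * (1 + r * (b / a - 1)) ≤ b ^ r := by
    rw [h1]; gcongr
  have h5 : a ^ r * (1 + r * (b / a - 1)) = a ^ r + r * a ^ (r - 1) * (b - a) := by
    rw [h3]; field_simp
  nlinarith

/-- Local Lipschitz bound for the duality map `x ↦ |x| ^ (p - 2) * x`. -/
lemma abs_rpow_mul_sub_le {p : ℝ} (hp : 2 ≤ p) (x z : ℝ) :
    |(|z| ^ (p - 2) * z - |x| ^ (p - 2) * x)| ≤ (p - 1) * (max |x| |z|) ^ (p - 2) * |z - x| := by
  have key : ∀ {y : ℝ}, 0 ≤ y → y ^ (p - 2) * y = y ^ (p - 1) := by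
    intro y hy
    rw [show p - 1 = (p - 2) + 1 by ring,
      Real.rpow_add_one' hy (by linarith)]
  have main : ∀ x z : ℝ, 0 ≤ z → |x| ≤ z →
      |(|z| ^ (p - 2) * z - |x| ^ (p - 2) * x)| ≤ (p - 1) * z ^ (p - 2) * |z - x| := by
    intro x z hz hxz
    have hxz' : x ≤ z := (le_abs_self x).trans hxz
    rw [abs_of_nonneg hz, abs_of_nonneg (sub_nonneg.2 hxz')]
    rcases le_total 0 x with hx | hx
    · rw [abs_of_nonneg hx, key hz, key hx, abs_of_nonneg]
      · have := rpow_sub_rpow_le (r := p - 1) (by linarith) hx hxz'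
        rwa [show p - 1 - 1 = p - 2 by ring] at this
      · exact sub_nonneg.2 (Real.rpow_le_rpow hx hxz' (by linarith))
    · rw [abs_of_nonpos hx] at hxz ⊢
      have h1 : (-x) ^ (p - 2) ≤ z ^ (p - 2) :=
        Real.rpow_le_rpow (by linarith) hxz (by linarith)
      have h2 : 0 ≤ (-x) ^ (p - 2) := Real.rpow_nonneg (by linarith) _
      have h3 : 0 ≤ z ^ (p - 2) := Real.rpow_nonneg hz _
      rw [abs_of_nonneg (by nlinarith)]
      have h4 : z ^ (p - 2) * (z - x) ≤ (p - 1) * z ^ (p - 2) * (z - x) := by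
        have : 0 ≤ z ^ (p - 2) * (z - x) := mul_nonneg h3 (by linarith)
        nlinarith
      nlinarith
  have main2 : ∀ x z : ℝ, |x| ≤ |z| →
      |(|z| ^ (p - 2) * z - |x| ^ (p - 2) * x)| ≤ (p - 1) * |z| ^ (p - 2) * |z - x| := by
    intro x z hxz
    rcases le_total 0 z with hz | hz
    · have := main x z hz (by rwa [abs_of_nonneg hz] at hxz)
      rwa [abs_of_nonneg hz] at this ⊢
    · have := main (-x) (-z) (by linarith) (by rwa [abs_of_nonpos hz, ← abs_neg x] at hxz)
      rw [abs_neg, abs_neg, ← abs_neg] at this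
      rw [abs_of_nonpos hz, ← abs_neg (z - x)]
      rw [abs_of_nonpos hz] at this
      convert this using 3 <;> ring
  rcases le_total |x| |z| with h | h
  · rw [max_eq_right h]; exact main2 x z h
  · rw [max_eq_left h, abs_sub_comm, abs_sub_comm z]; exact main2 z x h

/-- Second order expansion of `|x + y| ^ p` with an explicit remainder. -/
lemma abs_add_rpow_le {p : ℝ} (hp : 2 ≤ p) (x y : ℝ) :
    |x + y| ^ p ≤ |x| ^ p + p * (|x| ^ (p - 2) * x) * y +
      p * (p - 1) * 2 ^ (p - 2) * (|x| ^ (p - 2) * y ^ 2 + |y| ^ p) := by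
  set g : ℝ → ℝ := fun t => |t| ^ (p - 2) * t with hg
  -- convexity of `|·| ^ p`, in the form of Young's inequality
  have h1 : |x + y| ^ p ≤ |x| ^ p + p * g (x + y) * y := by
    set z := x + y
    have hpq : p.HolderConjugate (p / (p - 1)) :=
      Real.HolderConjugate.conjExponent (by linarith)
    have hy := Real.young_inequality_of_nonneg (abs_nonneg x)
      (Real.rpow_nonneg (abs_nonneg z) (p - 1)) hpq
    rw [← Real.rpow_mul (abs_nonneg z),
      show (p - 1) * (p / (p - 1)) = p by field_simp [show p - 1 ≠ 0 by linarith]] at hy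
    have hz1 : |z| ^ (p - 1) = |z| ^ (p - 2) * |z| := by
      rw [show p - 1 = (p - 2) + 1 by ring,
        Real.rpow_add_one' (abs_nonneg z) (by linarith)]
    have hz2 : |z| ^ p = |z| ^ (p - 2) * z ^ 2 := by
      rw [← sq_abs z, ← Real.rpow_natCast, ← Real.rpow_add_of_nonneg (abs_nonneg z)
        (by linarith) (by simp)]
      simp
    have hy2 : p * (|x| * |z| ^ (p - 1)) ≤ |x| ^ p + (p - 1) * |z| ^ p := by
      have hp0 : 0 < p := by linarith
      calc p * (|x| * |z| ^ (p - 1)) ≤ p * (|x| ^ p / p + |z| ^ p / (p / (p - 1))) := by gcongr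
        _ = _ := by field_simp
    have hxz : x * z ≤ |x| * |z| := by rw [← abs_mul]; exact le_abs_self _
    have hn : 0 ≤ |z| ^ (p - 2) := Real.rpow_nonneg (abs_nonneg z) _
    have h3 : p * (g z * x) ≤ p * (|x| * |z| ^ (p - 1)) := by
      rw [hz1]
      have : |z| ^ (p - 2) * (x * z) ≤ |z| ^ (p - 2) * (|x| * |z|) := by gcongr
      simp only [hg]
      nlinarith
    have hyx : y = z - x := by simp [z]
    have h4 : g z * z = |z| ^ p := by rw [hz2]; simp only [hg]; ring
    rw [hyx]
    nlinarith
  have h2 : |g (x + y) - g x| ≤ (p - 1) * (max |x| |x + y|) ^ (p - 2) * |y| := by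
    simpa using abs_rpow_mul_sub_le hp x (x + y)
  have h3 : (max |x| |x + y|) ^ (p - 2) ≤ 2 ^ (p - 2) * (|x| ^ (p - 2) + |y| ^ (p - 2)) := by
    have hm : max |x| |x + y| ≤ 2 * max |x| |y| := by
      have := abs_add_le x y
      have := le_max_left |x| |y|
      have := le_max_right |x| |y|
      have := abs_nonneg x
      apply max_le <;> linarith
    calc (max |x| |x + y|) ^ (p - 2) ≤ (2 * max |x| |y|) ^ (p - 2) :=
          Real.rpow_le_rpow (by positivity) hm (by linarith)
      _ = 2 ^ (p - 2) * (max |x| |y|) ^ (p - 2) := Real.mul_rpow (by simp) (by positivity)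
      _ ≤ _ := by
        gcongr
        rcases max_choice |x| |y| with h | h <;> rw [h]
        · exact le_add_of_nonneg_right (by positivity)
        · exact le_add_of_nonneg_left (by positivity)
  have h4 : (g (x + y) - g x) * y ≤
      (p - 1) * (2 ^ (p - 2) * (|x| ^ (p - 2) + |y| ^ (p - 2))) * y ^ 2 := by
    calc (g (x + y) - g x) * y ≤ |g (x + y) - g x| * |y| := by
          rw [← abs_mul]; exact le_abs_self _
      _ ≤ ((p - 1) * (max |x| |x + y|) ^ (p - 2) * |y|) * |y| := by gcongr
      _ = (p - 1) * (max |x| |x + y|) ^ (p - 2) * y ^ 2 := by rw [← sq_abs y]; ring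
      _ ≤ _ := by
        have : 0 ≤ p - 1 := by linarith
        gcongr
  have h5 : |y| ^ p = |y| ^ (p - 2) * y ^ 2 := by
    rw [← sq_abs y, ← Real.rpow_natCast, ← Real.rpow_add_of_nonneg (abs_nonneg y)
      (by linarith) (by simp)]
    simp
  have h6 : p * g (x + y) * y = p * g x * y + p * ((g (x + y) - g x) * y) := by ring
  have h7 : p * ((g (x + y) - g x) * y) ≤ p * ((p - 1) * (2 ^ (p - 2) *
      (|x| ^ (p - 2) + |y| ^ (p - 2))) * y ^ 2) := by gcongr
  rw [h5]
  calc |x + y| ^ p ≤ |x| ^ p + p * g (x + y) * y := h1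
    _ ≤ |x| ^ p + (p * g x * y + p * ((p - 1) * (2 ^ (p - 2) *
      (|x| ^ (p - 2) + |y| ^ (p - 2))) * y ^ 2)) := by rw [h6]; linarith
    _ = _ := by simp only [hg]; ring

/-- The constant in the two-smoothness inequality `eLpNorm_add_sq_le`. -/
noncomputable def smoothConst (p : ℝ) : ℝ := 2 * (p * (p - 1) * 2 ^ (p - 2))

lemma one_le_smoothConst {p : ℝ} (hp : 2 ≤ p) : 1 ≤ smoothConst p := by
  have : (1 : ℝ) ≤ 2 ^ (p - 2) := Real.one_le_rpow (by norm_num) (by linarith)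
  have : 1 ≤ p * (p - 1) := by nlinarith
  unfold smoothConst
  nlinarith

/-- Passage from `p`-th powers of norms to squares of norms. -/
lemma sq_le_of_rpow_le {p : ℝ} (hp : 2 ≤ p) {a b t : ℝ} (ha : 0 ≤ a) (hb : 0 ≤ b) (ht : 0 ≤ t)
    (h : t ^ p ≤ a ^ p + smoothConst p / 2 * (a ^ (p - 2) * b ^ 2 + b ^ p)) :
    t ^ 2 ≤ a ^ 2 + smoothConst p * b ^ 2 := by
  set D := smoothConst p with hD
  have hD1 : 1 ≤ D := one_le_smoothConst hp
  have sqp : ∀ {u : ℝ}, 0 ≤ u → u ^ p = (u ^ 2) ^ (p / 2) := by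
    intro u hu
    rw [← Real.rpow_natCast_mul hu]; congr 1; push_cast; ring
  have hq : 1 ≤ p / 2 := by linarith
  set s := a ^ 2
  set r := D * b ^ 2
  have hs : 0 ≤ s := by positivity
  have hr : 0 ≤ r := by positivity
  -- superadditivity and Bernoulli each bound `(s + r) ^ (p / 2)` from below; average them
  have h1 : s ^ (p / 2) + r ^ (p / 2) ≤ (s + r) ^ (p / 2) := Real.add_rpow_le_rpow_add hs hr hq
  have h2 : s ^ (p / 2) + p / 2 * (a ^ (p - 2) * r) ≤ (s + r) ^ (p / 2) := by
    rcases ha.eq_or_lt with ha0 | ha0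
    · rcases hp.eq_or_lt with hp2 | hp2
      · rw [← hp2]; simp
      · rw [← ha0, Real.zero_rpow (by linarith : p - 2 ≠ 0)]
        have : s = 0 := by simp [s, ← ha0]
        rw [this, Real.zero_rpow (by linarith)]; simp; positivity
    · have hs0 : 0 < s := by positivity
      have hB := one_add_mul_self_le_rpow_one_add (s := r / s)
        (by have : 0 ≤ r / s := by positivity
            linarith) hq
      have e1 : (s + r) ^ (p / 2) = s ^ (p / 2) * (1 + r / s) ^ (p / 2) := by
        rw [← Real.mul_rpow hs (by positivity)]; congr 1; field_simp
      have e2 : s ^ (p / 2) = a ^ (p - 2) * s := by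
        rw [← sqp ha, show p = (p - 2) + 2 by ring, Real.rpow_add ha0]; simp [s]
      calc s ^ (p / 2) + p / 2 * (a ^ (p - 2) * r) = s ^ (p / 2) * (1 + p / 2 * (r / s)) := by
            rw [e2]; field_simp
        _ ≤ _ := by rw [e1]; gcongr
  have h3 : D * b ^ p ≤ r ^ (p / 2) := by
    rw [Real.mul_rpow (by linarith) (by positivity), ← sqp hb]
    gcongr
    calc D = D ^ (1 : ℝ) := by simp
      _ ≤ _ := Real.rpow_le_rpow_of_exponent_le hD1 hq
  have h4 : t ^ p ≤ (s + r) ^ (p / 2) := by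
    have e : 0 ≤ a ^ (p - 2) * b ^ 2 := by positivity
    have h5 : D * (a ^ (p - 2) * b ^ 2) ≤ p / 2 * (a ^ (p - 2) * r) := by
      have : p / 2 * (a ^ (p - 2) * r) = (p / 2) * (D * (a ^ (p - 2) * b ^ 2)) := by
        simp only [r]; ring
      rw [this]
      nlinarith [mul_nonneg (by linarith : 0 ≤ D) e]
    rw [sqp ha] at h
    linarith
  rw [sqp ht] at h4
  exact (Real.rpow_le_rpow_iff (by positivity) (by positivity) (by linarith)).1 h4

/-! ### Two-smoothness of `Lᵖ` norms: martingale increments -/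

section Smooth

lemma _root_.MeasureTheory.StronglyMeasurable.abs_rpow_mul_self {Ω : Type*} {m : MeasurableSpace Ω}
    {X : Ω → ℝ} (hX : StronglyMeasurable X) (r : ℝ) :
    StronglyMeasurable fun ω => |X ω| ^ r * X ω :=
  ((hX.measurable.abs.pow_const r).mul hX.measurable).stronglyMeasurable

variable {Ω : Type*} {m m0 : MeasurableSpace Ω} {μ : Measure Ω}

lemma lpNorm_rpow_eq_integral {p : ℝ} (hp : 0 < p) {X : Ω → ℝ}
    (hX : AEStronglyMeasurable X μ) :
    lpNorm X (ENNReal.ofReal p) μ ^ p = ∫ ω, |X ω| ^ p ∂μ := by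
  rw [lpNorm_eq_integral_norm_rpow_toReal (by simpa using hp) ENNReal.ofReal_ne_top hX,
    ENNReal.toReal_ofReal hp.le, ← Real.rpow_mul (integral_nonneg fun _ => by positivity),
    inv_mul_cancel₀ hp.ne', Real.rpow_one]
  rfl

lemma integrable_abs_rpow {p : ℝ} (hp : 0 < p) {X : Ω → ℝ}
    (hX : MemLp X (ENNReal.ofReal p) μ) : Integrable (fun ω => |X ω| ^ p) μ := by
  have := hX.integrable_norm_rpow (by simpa using hp) ENNReal.ofReal_ne_top
  simpa [ENNReal.toReal_ofReal hp.le] using this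

/-- Young-type domination which makes the mixed terms of the expansion integrable. -/
lemma rpow_mul_rpow_le_add {r s a b : ℝ} (hr : 0 ≤ r) (hs : 0 ≤ s)
    (ha : 0 ≤ a) (hb : 0 ≤ b) :
    a ^ r * b ^ s ≤ a ^ (r + s) + b ^ (r + s) := by
  rcases le_total a b with h | h
  · calc a ^ r * b ^ s ≤ b ^ r * b ^ s := by gcongr
      _ = b ^ (r + s) := (Real.rpow_add_of_nonneg hb hr hs).symm
      _ ≤ _ := le_add_of_nonneg_left (by positivity)
  · calc a ^ r * b ^ s ≤ a ^ r * a ^ s := by gcongr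
      _ = a ^ (r + s) := (Real.rpow_add_of_nonneg ha hr hs).symm
      _ ≤ _ := le_add_of_nonneg_right (by positivity)

lemma integrable_abs_rpow_mul_abs_rpow {r s : ℝ} (hr : 0 ≤ r) (hs : 0 ≤ s) (hrs : 0 < r + s)
    {X Y : Ω → ℝ} (hX : MemLp X (ENNReal.ofReal (r + s)) μ)
    (hY : MemLp Y (ENNReal.ofReal (r + s)) μ) :
    Integrable (fun ω => |X ω| ^ r * |Y ω| ^ s) μ := by
  refine ((integrable_abs_rpow hrs hX).add (integrable_abs_rpow hrs hY)).mono' ?_ ?_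
  · have h1 := hX.1.aemeasurable
    have h2 := hY.1.aemeasurable
    exact ((h1.abs.pow_const r).mul (h2.abs.pow_const s)).aestronglyMeasurable
  · filter_upwards with ω
    rw [Real.norm_of_nonneg (by positivity)]
    exact rpow_mul_rpow_le_add hr hs (abs_nonneg _) (abs_nonneg _)

/-- Hölder's inequality in the form used for the second order term. -/
lemma integral_rpow_mul_sq_le {p : ℝ} (hp : 2 ≤ p) [IsProbabilityMeasure μ] {X Y : Ω → ℝ}
    (hX : MemLp X (ENNReal.ofReal p) μ) (hY : MemLp Y (ENNReal.ofReal p) μ) :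
    ∫ ω, |X ω| ^ (p - 2) * Y ω ^ 2 ∂μ ≤
      lpNorm X (ENNReal.ofReal p) μ ^ (p - 2) * lpNorm Y (ENNReal.ofReal p) μ ^ 2 := by
  have hp0 : 0 < p := by linarith
  have hy := lpNorm_rpow_eq_integral hp0 hY.1
  have hx := lpNorm_rpow_eq_integral hp0 hX.1
  rcases hp.eq_or_lt with rfl | hp2
  · simp only [sub_self, Real.rpow_zero, one_mul]
    rw [← Real.rpow_natCast _ 2]
    push_cast
    rw [hy]
    simp
  have hpq : (p / (p - 2)).HolderConjugate (p / 2) := by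
    rw [Real.holderConjugate_iff]
    constructor
    · rw [lt_div_iff₀ (by linarith)]; linarith
    · field_simp; ring
  have hp2' : p - 2 ≠ 0 := by linarith
  have key := integral_mul_le_Lp_mul_Lq_of_nonneg (μ := μ) hpq
    (f := fun ω => |X ω| ^ (p - 2)) (g := fun ω => Y ω ^ 2)
    (ae_of_all _ fun _ => by positivity) (ae_of_all _ fun _ => by positivity) ?_ ?_
  · refine key.trans (le_of_eq ?_)
    have e1 : ∀ ω, (|X ω| ^ (p - 2)) ^ (p / (p - 2)) = |X ω| ^ p := fun ω => by
      rw [← Real.rpow_mul (abs_nonneg _)]; congr 1; field_simp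
    have e2 : ∀ ω, (Y ω ^ 2) ^ (p / 2) = |Y ω| ^ p := fun ω => by
      rw [← sq_abs, ← Real.rpow_natCast, ← Real.rpow_mul (abs_nonneg _)]; congr 1
      push_cast; field_simp
    simp_rw [e1, e2, ← hx, ← hy]
    rw [← Real.rpow_mul lpNorm_nonneg, ← Real.rpow_mul lpNorm_nonneg, ← Real.rpow_natCast _ 2]
    congr 2
    · field_simp
    · push_cast; field_simp
  · have h1 : AEStronglyMeasurable (fun ω => |X ω| ^ (p - 2)) μ :=
      (hX.1.aemeasurable.abs.pow_const _).aestronglyMeasurable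
    rw [← integrable_norm_rpow_iff h1 (by simpa using div_pos hp0 (by linarith))
      ENNReal.ofReal_ne_top, ENNReal.toReal_ofReal (by exact (div_pos hp0 (by linarith)).le)]
    refine (integrable_abs_rpow hp0 hX).congr (ae_of_all _ fun ω => ?_)
    simp only
    rw [Real.norm_of_nonneg (by positivity), ← Real.rpow_mul (abs_nonneg _)]
    congr 1; field_simp
  · have h1 : AEStronglyMeasurable (fun ω => Y ω ^ 2) μ := hY.1.pow 2
    rw [← integrable_norm_rpow_iff h1 (by simp; linarith)
      ENNReal.ofReal_ne_top, ENNReal.toReal_ofReal (by linarith)]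
    refine (integrable_abs_rpow hp0 hY).congr (ae_of_all _ fun ω => ?_)
    simp only
    rw [Real.norm_of_nonneg (by positivity), ← sq_abs, ← Real.rpow_natCast,
      ← Real.rpow_mul (abs_nonneg _)]
    congr 1
    push_cast; field_simp

/-- Adding to an `m`-measurable variable one whose conditional expectation given `m` vanishes
increases the squared `Lᵖ` norm by at most a constant multiple of the squared norm of the
increment. -/
lemma lpNorm_add_sq_le {p : ℝ} (hp : 2 ≤ p) [IsProbabilityMeasure μ] {X Y : Ω → ℝ}
    (hm : m ≤ m0)
    (hX : MemLp X (ENNReal.ofReal p) μ) (hXm : StronglyMeasurable[m] X)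
    (hY : MemLp Y (ENNReal.ofReal p) μ) (hYm : μ[Y | m] =ᵐ[μ] 0) :
    lpNorm (X + Y) (ENNReal.ofReal p) μ ^ 2 ≤ lpNorm X (ENNReal.ofReal p) μ ^ 2 +
      smoothConst p * lpNorm Y (ENNReal.ofReal p) μ ^ 2 := by
  have hp0 : 0 < p := by linarith
  have hp1 : (1 : ℝ≥0∞) ≤ ENNReal.ofReal p := by
    rw [← ENNReal.ofReal_one]; exact ENNReal.ofReal_le_ofReal (by linarith)
  have hYi : Integrable Y μ := hY.integrable hp1
  set g : Ω → ℝ := fun ω => |X ω| ^ (p - 2) * X ω with hg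
  have hgm : StronglyMeasurable[m] g := hXm.abs_rpow_mul_self (p - 2)
  have hgY : Integrable (g * Y) μ := by
    have hX' : MemLp X (ENNReal.ofReal ((p - 1) + 1)) μ := by simpa using hX
    have hY' : MemLp Y (ENNReal.ofReal ((p - 1) + 1)) μ := by simpa using hY
    refine (integrable_abs_rpow_mul_abs_rpow (by linarith) zero_le_one (by linarith)
      hX' hY').mono' ((hgm.mono hm).aestronglyMeasurable.mul hY.1) (ae_of_all _ fun ω => ?_)
    simp only [hg, Pi.mul_apply, norm_mul, Real.norm_eq_abs, Real.rpow_one]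
    rw [abs_of_nonneg (Real.rpow_nonneg (abs_nonneg (X ω)) _),
      show p - 1 = (p - 2) + 1 by ring, Real.rpow_add_one' (abs_nonneg _) (by linarith)]
  have hzero : ∫ ω, (g * Y) ω ∂μ = 0 := by
    rw [← integral_condExp hm]
    have h1 := condExp_mul_of_stronglyMeasurable_left hgm hgY hYi
    rw [integral_congr_ae (h1.trans (hYm.mono fun ω h => by
      simp only [Pi.mul_apply, h] : g * μ[Y | m] =ᵐ[μ] g * 0))]
    simp
  have hmix : Integrable (fun ω => |X ω| ^ (p - 2) * Y ω ^ 2) μ := by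
    have hX' : MemLp X (ENNReal.ofReal ((p - 2) + 2)) μ := by simpa using hX
    have hY' : MemLp Y (ENNReal.ofReal ((p - 2) + 2)) μ := by simpa using hY
    refine (integrable_abs_rpow_mul_abs_rpow (by linarith) zero_le_two (by linarith)
      hX' hY').congr (ae_of_all _ fun ω => ?_)
    simp
  refine sq_le_of_rpow_le hp lpNorm_nonneg lpNorm_nonneg lpNorm_nonneg ?_
  rw [lpNorm_rpow_eq_integral hp0 (hX.1.add hY.1), lpNorm_rpow_eq_integral hp0 hX.1,
    lpNorm_rpow_eq_integral hp0 hY.1]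
  have hXi := integrable_abs_rpow hp0 hX
  have hYi := integrable_abs_rpow hp0 hY
  have hc : smoothConst p / 2 = p * (p - 1) * 2 ^ (p - 2) := by unfold smoothConst; ring
  have hc0 : 0 ≤ smoothConst p / 2 := by linarith [one_le_smoothConst hp]
  calc ∫ ω, |(X + Y) ω| ^ p ∂μ
      ≤ ∫ ω, (|X ω| ^ p + p * (g * Y) ω +
          smoothConst p / 2 * (|X ω| ^ (p - 2) * Y ω ^ 2 + |Y ω| ^ p)) ∂μ := by
        refine integral_mono (integrable_abs_rpow hp0 (hX.add hY))
          ((hXi.add (hgY.const_mul p)).add ((hmix.add hYi).const_mul _)) fun ω => ?_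
        have := abs_add_rpow_le hp (X ω) (Y ω)
        simp only [Pi.add_apply, hg, Pi.mul_apply, hc]
        linarith
    _ = ∫ ω, |X ω| ^ p ∂μ +
          smoothConst p / 2 * (∫ ω, |X ω| ^ (p - 2) * Y ω ^ 2 ∂μ + ∫ ω, |Y ω| ^ p ∂μ) := by
        have h1 := integral_add hmix hYi
        have h2 := integral_add hXi (hgY.const_mul p)
        have h3 := integral_add (hXi.add (hgY.const_mul p))
          ((hmix.add hYi).const_mul (smoothConst p / 2))
        simp only [Pi.add_apply, integral_const_mul, hzero, mul_zero, add_zero] at h1 h2 h3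
        rw [h3, h2, h1]
    _ ≤ _ := by
        gcongr
        exact integral_rpow_mul_sq_le hp hX hY

end Smooth

/-! ### Exchanging coordinates with an independent copy -/

section Exchange

variable {ι 𝓧 : Type*} [MeasurableSpace 𝓧]

open scoped Classical in
/-- Exchange, in a pair of families, of the coordinates outside `S`. -/
noncomputable def exchange (S : Set ι) (z : (ι → 𝓧) × (ι → 𝓧)) : (ι → 𝓧) × (ι → 𝓧) :=
  (S.piecewise z.1 z.2, S.piecewise z.2 z.1)

lemma measurable_exchange (S : Set ι) : Measurable (exchange (𝓧 := 𝓧) S) := by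
  classical
  unfold exchange
  refine Measurable.prodMk ?_ ?_ <;>
  · refine measurable_pi_iff.2 fun k => ?_
    by_cases hk : k ∈ S
    · simp only [Set.piecewise, hk, if_true]; fun_prop
    · simp only [Set.piecewise, hk, if_false]; fun_prop

open scoped Classical in
/-- The permutation of two copies of the index set which interchanges the two copies of every
index outside `S`. -/
noncomputable def exchangeEquiv (S : Set ι) : ι ⊕ ι ≃ ι ⊕ ι :=
  Function.Involutive.toPerm
    (fun s => if s.elim id id ∈ S then s else s.swap) (by
      rintro (k | k) <;> by_cases hk : k ∈ S <;> simp [hk])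

lemma exchangeEquiv_inl_of_mem {S : Set ι} {k : ι} (hk : k ∈ S) :
    exchangeEquiv S (Sum.inl k) = Sum.inl k := if_pos hk

lemma exchangeEquiv_inl_of_notMem {S : Set ι} {k : ι} (hk : k ∉ S) :
    exchangeEquiv S (Sum.inl k) = Sum.inr k := if_neg hk

lemma exchangeEquiv_inr_of_mem {S : Set ι} {k : ι} (hk : k ∈ S) :
    exchangeEquiv S (Sum.inr k) = Sum.inr k := if_pos hk

lemma exchangeEquiv_inr_of_notMem {S : Set ι} {k : ι} (hk : k ∉ S) :
    exchangeEquiv S (Sum.inr k) = Sum.inl k := if_neg hk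

variable (ν : ι → Measure 𝓧) [∀ k, IsProbabilityMeasure (ν k)]

instance (s : ι ⊕ ι) : IsProbabilityMeasure (Sum.elim ν ν s) := by
  cases s <;> simp only [Sum.elim_inl, Sum.elim_inr] <;> infer_instance

/-- A pair of independent families of independent variables is one independent family, indexed by
two copies of the index set. -/
lemma map_sum_infinitePi_prod :
    ((Measure.infinitePi ν).prod (Measure.infinitePi ν)).map
      (fun z => (Sum.elim z.1 z.2 : ι ⊕ ι → 𝓧)) = Measure.infinitePi (Sum.elim ν ν) := by
  classical
  have hmeas : Measurable fun z : (ι → 𝓧) × (ι → 𝓧) => (Sum.elim z.1 z.2 : ι ⊕ ι → 𝓧) := by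
    refine measurable_pi_iff.2 ?_
    rintro (k | k) <;> simp only [Sum.elim_inl, Sum.elim_inr] <;> fun_prop
  refine Measure.eq_infinitePi _ fun s t ht => ?_
  rw [Measure.map_apply hmeas (.pi s.countable_toSet fun _ _ => ht _)]
  have : (fun z : (ι → 𝓧) × (ι → 𝓧) => (Sum.elim z.1 z.2 : ι ⊕ ι → 𝓧)) ⁻¹' (Set.pi s t) =
      (Set.pi s.toLeft fun k => t (Sum.inl k)) ×ˢ (Set.pi s.toRight fun k => t (Sum.inr k)) := by
    ext z
    simp [Set.mem_pi]
  rw [this, Measure.prod_prod, Measure.infinitePi_pi _ fun _ _ => ht _,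
    Measure.infinitePi_pi _ fun _ _ => ht _]
  conv_rhs => rw [← Finset.toLeft_disjSum_toRight (u := s)]
  rw [Finset.prod_disjSum]
  rfl

/-- Exchanging coordinates does not change the law of a pair of independent copies. -/
lemma map_exchange (S : Set ι) :
    ((Measure.infinitePi ν).prod (Measure.infinitePi ν)).map (exchange S) =
      (Measure.infinitePi ν).prod (Measure.infinitePi ν) := by
  classical
  set μ := Measure.infinitePi ν
  have hJ : Measurable fun z : (ι → 𝓧) × (ι → 𝓧) => (Sum.elim z.1 z.2 : ι ⊕ ι → 𝓧) := by
    refine measurable_pi_iff.2 ?_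
    rintro (k | k) <;> simp only [Sum.elim_inl, Sum.elim_inr] <;> fun_prop
  let J' : (ι ⊕ ι → 𝓧) → (ι → 𝓧) × (ι → 𝓧) := fun x => (fun k => x (.inl k), fun k => x (.inr k))
  have hJ' : Measurable J' := by fun_prop
  set σ := exchangeEquiv S
  have hσ : (fun s => Sum.elim ν ν (σ s)) = Sum.elim ν ν := by
    funext s
    rcases s with k | k <;> by_cases hk : k ∈ S <;>
      simp [σ, hk, exchangeEquiv_inl_of_mem, exchangeEquiv_inl_of_notMem,
        exchangeEquiv_inr_of_mem, exchangeEquiv_inr_of_notMem]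
  have h1 : (Measure.infinitePi (Sum.elim ν ν)).map
      (MeasurableEquiv.piCongrLeft (fun _ => 𝓧) σ) = Measure.infinitePi (Sum.elim ν ν) := by
    have := Measure.infinitePi_map_piCongrLeft (Sum.elim ν ν) σ
    rwa [hσ] at this
  have h2 : exchange S = J' ∘ (MeasurableEquiv.piCongrLeft (fun _ => 𝓧) σ) ∘
      (fun z : (ι → 𝓧) × (ι → 𝓧) => (Sum.elim z.1 z.2 : ι ⊕ ι → 𝓧)) := by
    have hsymm : ∀ (x : ι ⊕ ι → 𝓧) s, MeasurableEquiv.piCongrLeft (fun _ => 𝓧) σ x s = x (σ s) := by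
      intro x s
      have := MeasurableEquiv.piCongrLeft_apply_apply (β := fun _ => 𝓧) σ x (σ s)
      rwa [show σ (σ s) = s from Function.Involutive.toPerm_involutive _ s] at this
    funext z
    simp only [Function.comp, J', hsymm]
    refine Prod.ext ?_ ?_ <;> funext k <;> by_cases hk : k ∈ S <;>
      simp [exchange, σ, hk, exchangeEquiv_inl_of_mem, exchangeEquiv_inl_of_notMem,
        exchangeEquiv_inr_of_mem, exchangeEquiv_inr_of_notMem]
  rw [h2, ← Measure.map_map hJ' ((MeasurableEquiv.measurable _).comp hJ),
    ← Measure.map_map (MeasurableEquiv.measurable _) hJ, map_sum_infinitePi_prod, h1,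
    ← map_sum_infinitePi_prod, Measure.map_map hJ' hJ]
  exact Measure.map_id

lemma measurePreserving_exchange (S : Set ι) :
    MeasurePreserving (exchange S) ((Measure.infinitePi ν).prod (Measure.infinitePi ν))
      ((Measure.infinitePi ν).prod (Measure.infinitePi ν)) :=
  ⟨measurable_exchange S, map_exchange ν S⟩

lemma measurePreserving_fst_exchange (S : Set ι) :
    MeasurePreserving (fun z => (exchange S z).1)
      ((Measure.infinitePi ν).prod (Measure.infinitePi ν)) (Measure.infinitePi ν) :=
  measurePreserving_fst.comp (measurePreserving_exchange ν S)

end Exchange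

/-! ### Averaging out coordinates -/

section PartialMean

variable {ι 𝓧 : Type*} [MeasurableSpace 𝓧]

/-- The `σ`-algebra generated by the coordinates in `S`. -/
abbrev coordSigma (𝓧 : Type*) [MeasurableSpace 𝓧] (S : Set ι) : MeasurableSpace (ι → 𝓧) :=
  MeasurableSpace.comap (fun (x : ι → 𝓧) (k : S) => x k) MeasurableSpace.pi

lemma coordSigma_le (S : Set ι) : coordSigma 𝓧 S ≤ MeasurableSpace.pi := by
  refine Measurable.comap_le ?_
  fun_prop

lemma coordSigma_mono {S T : Set ι} (h : S ⊆ T) : coordSigma 𝓧 S ≤ coordSigma 𝓧 T := by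
  have : (fun (x : ι → 𝓧) (k : S) => x k) =
      (fun (y : T → 𝓧) (k : S) => y ⟨k, h k.2⟩) ∘ (fun (x : ι → 𝓧) (k : T) => x k) := rfl
  unfold coordSigma
  rw [this, ← MeasurableSpace.comap_comp]
  refine MeasurableSpace.comap_mono (Measurable.comap_le ?_)
  fun_prop

variable (ν : ι → Measure 𝓧)

/-- The mean of `f` over the coordinates outside `S`. -/
noncomputable def partialMean (S : Set ι) (f : (ι → 𝓧) → ℝ) (x : ι → 𝓧) : ℝ :=
  ∫ x', f (exchange S (x, x')).1 ∂(Measure.infinitePi ν)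

variable {ν}

lemma partialMean_empty (f : (ι → 𝓧) → ℝ) (x : ι → 𝓧) :
    partialMean ν ∅ f x = ∫ y, f y ∂(Measure.infinitePi ν) := by
  simp [partialMean, exchange]

variable [∀ k, IsProbabilityMeasure (ν k)]

lemma stronglyMeasurable_partialMean (S : Set ι) {f : (ι → 𝓧) → ℝ} (hf : Measurable f) :
    StronglyMeasurable[coordSigma 𝓧 S] (partialMean ν S f) := by
  classical
  let ext : (S → 𝓧) × (ι → 𝓧) → (ι → 𝓧) := fun w k => if h : k ∈ S then w.1 ⟨k, h⟩ else w.2 k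
  have hext : Measurable ext := by
    refine measurable_pi_iff.2 fun k => ?_
    by_cases hk : k ∈ S
    · simp only [ext, hk, dite_true]; fun_prop
    · simp only [ext, hk, dite_false]; fun_prop
  have h1 : StronglyMeasurable fun y : S → 𝓧 => ∫ x', f (ext (y, x')) ∂(Measure.infinitePi ν) :=
    (hf.comp hext).stronglyMeasurable.integral_prod_right'
  have h2 : partialMean ν S f =
      (fun y : S → 𝓧 => ∫ x', f (ext (y, x')) ∂(Measure.infinitePi ν)) ∘
        (fun (x : ι → 𝓧) (k : S) => x k) := by
    funext x
    simp only [partialMean, Function.comp, exchange, ext]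
    rfl
  rw [h2]
  exact h1.comp_measurable (comap_measurable _)

lemma integrable_fst_exchange (S : Set ι) {f : (ι → 𝓧) → ℝ}
    (hf : Integrable f (Measure.infinitePi ν)) :
    Integrable (fun z : (ι → 𝓧) × (ι → 𝓧) => f (exchange S z).1)
      ((Measure.infinitePi ν).prod (Measure.infinitePi ν)) :=
  (measurePreserving_fst_exchange ν S).integrable_comp_of_integrable hf

/-- Averaging out independent coordinates computes the conditional expectation given the others. -/
lemma partialMean_ae_eq_condExp (S : Set ι) {f : (ι → 𝓧) → ℝ} (hf : Measurable f)
    (hfi : Integrable f (Measure.infinitePi ν)) :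
    partialMean ν S f =ᵐ[Measure.infinitePi ν] (Measure.infinitePi ν)[f | coordSigma 𝓧 S] := by
  classical
  have hint := integrable_fst_exchange S hfi
  have hpi : Integrable (partialMean ν S f) (Measure.infinitePi ν) := hint.integral_prod_left
  refine ae_eq_condExp_of_forall_setIntegral_eq (coordSigma_le S) hfi
    (fun _ _ _ => hpi.integrableOn) ?_
    (stronglyMeasurable_partialMean S hf).aestronglyMeasurable
  rintro A ⟨A', hA', rfl⟩ -
  set A := (fun (x : ι → 𝓧) (k : S) => x k) ⁻¹' A'
  have hA : MeasurableSet A := by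
    have : Measurable fun (x : ι → 𝓧) (k : S) => x k := by fun_prop
    exact this hA'
  have hmem : ∀ z : (ι → 𝓧) × (ι → 𝓧), (exchange S z).1 ∈ A ↔ z.1 ∈ A := by
    intro z
    have : (fun k : S => (exchange S z).1 k) = fun k : S => z.1 k := by
      funext k; simp [exchange]
    simp only [A, Set.mem_preimage, this]
  calc ∫ x in A, partialMean ν S f x ∂(Measure.infinitePi ν)
      = ∫ x, ∫ x', A.indicator f (exchange S (x, x')).1 ∂(Measure.infinitePi ν)
          ∂(Measure.infinitePi ν) := by
        rw [← integral_indicator hA]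
        congr 1 with x
        by_cases hx : x ∈ A
        · have : ∀ x', (exchange S (x, x')).1 ∈ A := fun x' => (hmem (x, x')).2 hx
          simp [hx, this, partialMean]
        · have : ∀ x', (exchange S (x, x')).1 ∉ A := fun x' => fun h => hx ((hmem (x, x')).1 h)
          simp [hx, this]
    _ = ∫ z, A.indicator f (exchange S z).1
          ∂((Measure.infinitePi ν).prod (Measure.infinitePi ν)) :=
        (integral_prod _ (integrable_fst_exchange S (hfi.indicator hA))).symm
    _ = ∫ x, A.indicator f x ∂(Measure.infinitePi ν) := by
        have h := measurePreserving_fst_exchange ν S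
        have h' := integral_map (μ := (Measure.infinitePi ν).prod (Measure.infinitePi ν))
          (f := A.indicator f) h.measurable.aemeasurable
          ((hf.indicator hA).aestronglyMeasurable)
        rw [h.map_eq] at h'
        exact h'.symm
    _ = ∫ x in A, f x ∂(Measure.infinitePi ν) := integral_indicator hA

/-- Minkowski's integral inequality for a probability average. -/
lemma eLpNorm_integral_prod_le {α β : Type*} [MeasurableSpace α] [MeasurableSpace β]
    {μ : Measure α} {ρ : Measure β} [SFinite μ] [IsProbabilityMeasure ρ] {p : ℝ} (hp : 1 ≤ p)
    {F : α × β → ℝ} (hF : Measurable F) :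
    eLpNorm (fun x => ∫ y, F (x, y) ∂ρ) (ENNReal.ofReal p) μ ≤
      eLpNorm F (ENNReal.ofReal p) (μ.prod ρ) := by
  have hp0 : 0 < p := by linarith
  have hp0' : ENNReal.ofReal p ≠ 0 := by simpa using hp0
  rw [eLpNorm_eq_lintegral_rpow_enorm_toReal hp0' ENNReal.ofReal_ne_top,
    eLpNorm_eq_lintegral_rpow_enorm_toReal hp0' ENNReal.ofReal_ne_top,
    ENNReal.toReal_ofReal hp0.le]
  gcongr
  rw [lintegral_prod _ (by fun_prop)]
  gcongr with x
  have hFx : Measurable fun y => F (x, y) := by fun_prop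
  have h1 : ‖∫ y, F (x, y) ∂ρ‖ₑ ≤ eLpNorm (fun y => F (x, y)) (ENNReal.ofReal p) ρ := by
    refine (enorm_integral_le_lintegral_enorm _).trans ?_
    rw [← eLpNorm_one_eq_lintegral_enorm]
    refine eLpNorm_le_eLpNorm_of_exponent_le ?_ hFx.aestronglyMeasurable
    rw [← ENNReal.ofReal_one]; exact ENNReal.ofReal_le_ofReal hp
  calc ‖∫ y, F (x, y) ∂ρ‖ₑ ^ p ≤ (eLpNorm (fun y => F (x, y)) (ENNReal.ofReal p) ρ) ^ p := by
        gcongr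
    _ = _ := by
        rw [eLpNorm_eq_lintegral_rpow_enorm_toReal hp0' ENNReal.ofReal_ne_top,
          ENNReal.toReal_ofReal hp0.le, ← ENNReal.rpow_mul, one_div, inv_mul_cancel₀ hp0.ne',
          ENNReal.rpow_one]

/-- The `Lᵖ` influence of the coordinate `k` on `f`: the size of the change of `f` when this
coordinate is replaced by an independent copy. -/
noncomputable def influence (ν : ι → Measure 𝓧) (p : ℝ) (f : (ι → 𝓧) → ℝ) (k : ι) : ℝ≥0∞ :=
  open scoped Classical in
  eLpNorm (fun z : (ι → 𝓧) × (ι → 𝓧) => f z.1 - f (Function.update z.1 k (z.2 k)))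
    (ENNReal.ofReal p) ((Measure.infinitePi ν).prod (Measure.infinitePi ν))

lemma measurable_update_copy (k : ι) [DecidableEq ι] :
    Measurable fun z : (ι → 𝓧) × (ι → 𝓧) => Function.update z.1 k (z.2 k) := by
  refine measurable_pi_iff.2 fun l => ?_
  by_cases hl : l = k
  · subst hl; simp only [Function.update_self]; fun_prop
  · simp only [Function.update_of_ne hl]; fun_prop

/-- Revealing one more coordinate changes the conditional expectation by at most the influence of
that coordinate. -/
lemma eLpNorm_partialMean_sub_le {p : ℝ} (hp : 1 ≤ p) {S T : Set ι} {k : ι}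
    (hT : T = insert k S) (hk : k ∉ S)
    {f : (ι → 𝓧) → ℝ} (hf : Measurable f) (hfi : Integrable f (Measure.infinitePi ν)) :
    eLpNorm (partialMean ν T f - partialMean ν S f) (ENNReal.ofReal p) (Measure.infinitePi ν) ≤
      influence ν p f k := by
  classical
  set μ := Measure.infinitePi ν
  set F : (ι → 𝓧) × (ι → 𝓧) → ℝ := fun z => f (exchange T z).1 - f (exchange S z).1 with hF
  have hFm : Measurable F :=
    (hf.comp (measurable_fst.comp (measurable_exchange T))).sub
      (hf.comp (measurable_fst.comp (measurable_exchange S)))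
  have h1 : partialMean ν T f - partialMean ν S f =ᵐ[μ] fun x => ∫ x', F (x, x') ∂μ := by
    filter_upwards [(integrable_fst_exchange T hfi).prod_right_ae,
      (integrable_fst_exchange S hfi).prod_right_ae] with x hxT hxS
    simp only [Pi.sub_apply, partialMean, hF]
    rw [integral_sub hxT hxS]
  rw [eLpNorm_congr_ae h1]
  refine (eLpNorm_integral_prod_le hp hFm).trans ?_
  -- after the exchange, the pair of arguments is a family and the same family with one coordinate
  -- replaced
  set H : (ι → 𝓧) × (ι → 𝓧) → ℝ := fun z => f z.1 - f (Function.update z.1 k (z.2 k)) with hH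
  have hHm : Measurable H := by
    have := measurable_update_copy (𝓧 := 𝓧) k
    exact (hf.comp measurable_fst).sub (hf.comp this)
  have h2 : F = H ∘ exchange T := by
    funext z
    simp only [hF, hH, Function.comp]
    congr 2
    funext l
    by_cases hl : l = k
    · subst hl; simp [exchange, hT, hk]
    · by_cases hlS : l ∈ S <;> simp [exchange, hT, hl, hlS]
  rw [h2, eLpNorm_comp_measurePreserving hHm.aestronglyMeasurable (measurePreserving_exchange ν T)]
  exact le_of_eq rfl

lemma memLp_partialMean {p : ℝ} (hp : 1 ≤ p) (S : Set ι) {f : (ι → 𝓧) → ℝ} (hf : Measurable f)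
    (hfp : MemLp f (ENNReal.ofReal p) (Measure.infinitePi ν)) :
    MemLp (partialMean ν S f) (ENNReal.ofReal p) (Measure.infinitePi ν) := by
  have hp1 : (1 : ℝ≥0∞) ≤ ENNReal.ofReal p := by
    rw [← ENNReal.ofReal_one]; exact ENNReal.ofReal_le_ofReal hp
  exact (hfp.condExp hp1).ae_eq (partialMean_ae_eq_condExp S hf (hfp.integrable hp1)).symm

end PartialMean

/-! ### Moment and covariance inequalities in terms of influences -/

section Influence

lemma one_le_ofReal {p : ℝ} (hp : 1 ≤ p) : (1 : ℝ≥0∞) ≤ ENNReal.ofReal p := by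
  rw [← ENNReal.ofReal_one]; exact ENNReal.ofReal_le_ofReal hp

lemma lpNorm_le_of_eLpNorm_le {α : Type*} [MeasurableSpace α] {μ : Measure α} {p : ℝ≥0∞}
    {X : α → ℝ} (hX : MemLp X p μ) {a : ℝ} (ha : 0 ≤ a)
    (h : eLpNorm X p μ ≤ ENNReal.ofReal a) : lpNorm X p μ ≤ a := by
  rw [← ofReal_lpNorm hX] at h
  exact (ENNReal.ofReal_le_ofReal_iff ha).1 h

lemma eLpNorm_le_ofReal_of_lpNorm_le {α : Type*} [MeasurableSpace α] {μ : Measure α} {p : ℝ≥0∞}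
    {X : α → ℝ} (hX : MemLp X p μ) {a : ℝ} (h : lpNorm X p μ ≤ a) :
    eLpNorm X p μ ≤ ENNReal.ofReal a := by
  rw [← ofReal_lpNorm hX]
  exact ENNReal.ofReal_le_ofReal h

/-- The Cauchy–Schwarz inequality for integrals. -/
lemma abs_integral_mul_le {α : Type*} [MeasurableSpace α] {μ : Measure α} {X Y : α → ℝ}
    (hX : MemLp X (ENNReal.ofReal 2) μ) (hY : MemLp Y (ENNReal.ofReal 2) μ) :
    |∫ ω, X ω * Y ω ∂μ| ≤ lpNorm X (ENNReal.ofReal 2) μ * lpNorm Y (ENNReal.ofReal 2) μ := by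
  have h := integral_mul_le_Lp_mul_Lq_of_nonneg (μ := μ) Real.HolderConjugate.two_two
    (f := fun ω => |X ω|) (g := fun ω => |Y ω|) (ae_of_all _ fun _ => abs_nonneg _)
    (ae_of_all _ fun _ => abs_nonneg _) hX.abs hY.abs
  rw [← lpNorm_rpow_eq_integral two_pos hX.1, ← lpNorm_rpow_eq_integral two_pos hY.1,
    ← Real.rpow_mul lpNorm_nonneg, ← Real.rpow_mul lpNorm_nonneg] at h
  simp only [one_div, ne_eq, OfNat.ofNat_ne_zero, not_false_eq_true, mul_inv_cancel₀,
    Real.rpow_one] at h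
  calc |∫ ω, X ω * Y ω ∂μ| ≤ ∫ ω, |X ω * Y ω| ∂μ := abs_integral_le_integral_abs
    _ = ∫ ω, |X ω| * |Y ω| ∂μ := by simp_rw [abs_mul]
    _ ≤ _ := h

lemma integrable_mul_of_memLp_two {α : Type*} [MeasurableSpace α] {μ : Measure α} {X Y : α → ℝ}
    (hX : MemLp X (ENNReal.ofReal 2) μ) (hY : MemLp Y (ENNReal.ofReal 2) μ) :
    Integrable (fun ω => X ω * Y ω) μ := by
  rw [ENNReal.ofReal_ofNat] at hX hY
  exact hX.integrable_mul hY

lemma integral_mul_eq_zero_of_condExp {α : Type*} {m m0 : MeasurableSpace α} {μ : Measure α}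
    [IsProbabilityMeasure μ] (hm : m ≤ m0) {X Y : α → ℝ}
    (hX : MemLp X (ENNReal.ofReal 2) μ) (hXm : StronglyMeasurable[m] X)
    (hY : MemLp Y (ENNReal.ofReal 2) μ) (hYm : μ[Y | m] =ᵐ[μ] 0) :
    ∫ ω, X ω * Y ω ∂μ = 0 := by
  have hXY : Integrable (X * Y) μ := integrable_mul_of_memLp_two hX hY
  have h1 := condExp_mul_of_stronglyMeasurable_left hXm hXY
    (hY.integrable (one_le_ofReal one_le_two))
  calc ∫ ω, X ω * Y ω ∂μ = ∫ ω, μ[X * Y | m] ω ∂μ := (integral_condExp hm).symm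
    _ = ∫ ω, (0 : ℝ) ∂μ := integral_congr_ae (by
        filter_upwards [h1, hYm] with ω h2 h3
        simp [h2, h3])
    _ = 0 := by simp

variable {ι 𝓧 : Type*} [MeasurableSpace 𝓧] {ν : ι → Measure 𝓧} [∀ k, IsProbabilityMeasure (ν k)]

/-- Successive partial means form a martingale. -/
lemma condExp_partialMean_sub {S T : Set ι} (hST : S ⊆ T) {f : (ι → 𝓧) → ℝ} (hf : Measurable f)
    (hfi : Integrable f (Measure.infinitePi ν)) :
    (Measure.infinitePi ν)[partialMean ν T f - partialMean ν S f | coordSigma 𝓧 S]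
      =ᵐ[Measure.infinitePi ν] 0 := by
  set μ := Measure.infinitePi ν
  have hT := partialMean_ae_eq_condExp T hf hfi
  have hS := partialMean_ae_eq_condExp S hf hfi
  have h1 : partialMean ν T f - partialMean ν S f =ᵐ[μ]
      μ[f | coordSigma 𝓧 T] - μ[f | coordSigma 𝓧 S] := hT.sub hS
  refine (condExp_congr_ae h1).trans ?_
  refine (condExp_sub integrable_condExp integrable_condExp _).trans ?_
  have h2 := condExp_condExp_of_le (μ := μ) (f := f) (coordSigma_mono hST) (coordSigma_le T)
  have h3 := condExp_condExp_of_le (μ := μ) (f := f) (le_refl (coordSigma 𝓧 S)) (coordSigma_le S)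
  filter_upwards [h2, h3] with x h2 h3
  simp [h2, h3]

lemma lpNorm_partialMean_le {p : ℝ} (hp : 1 ≤ p) (S : Set ι) {f : (ι → 𝓧) → ℝ} (hf : Measurable f)
    (hfp : MemLp f (ENNReal.ofReal p) (Measure.infinitePi ν)) :
    lpNorm (partialMean ν S f) (ENNReal.ofReal p) (Measure.infinitePi ν) ≤
      lpNorm f (ENNReal.ofReal p) (Measure.infinitePi ν) := by
  refine lpNorm_le_of_eLpNorm_le (memLp_partialMean hp S hf hfp) lpNorm_nonneg ?_
  rw [ofReal_lpNorm hfp, eLpNorm_congr_ae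
    (partialMean_ae_eq_condExp S hf (hfp.integrable (one_le_ofReal hp)))]
  exact eLpNorm_condExp_le_eLpNorm _ (one_le_ofReal hp)

variable [Denumerable ι]

/-- The first `N` indices in the enumeration of `ι`. -/
def firstIndices (ι : Type*) [Denumerable ι] (N : ℕ) : Set ι := {k | Encodable.encode k < N}

lemma firstIndices_succ (N : ℕ) :
    firstIndices ι (N + 1) = insert (Denumerable.ofNat ι N) (firstIndices ι N) := by
  ext k
  simp only [firstIndices, Set.mem_ofPred_eq, Set.mem_insert_iff]
  rw [Nat.lt_succ_iff_lt_or_eq, or_comm]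
  refine or_congr_left ⟨fun h => ?_, fun h => ?_⟩
  · rw [← h, Denumerable.ofNat_encode]
  · rw [h, Denumerable.encode_ofNat]

lemma ofNat_notMem_firstIndices (N : ℕ) : Denumerable.ofNat ι N ∉ firstIndices ι N := by
  simp [firstIndices]

lemma firstIndices_mono : Monotone (firstIndices ι) := fun _ _ h _ hk => lt_of_lt_of_le hk h

lemma firstIndices_zero : firstIndices ι 0 = ∅ := by simp [firstIndices]

/-- The filtration which reveals the coordinates one after the other. -/
def coordFiltration (ι 𝓧 : Type*) [MeasurableSpace 𝓧] [Denumerable ι] :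
    Filtration ℕ (MeasurableSpace.pi : MeasurableSpace (ι → 𝓧)) where
  seq N := coordSigma 𝓧 (firstIndices ι N)
  mono' _ _ h := coordSigma_mono (firstIndices_mono h)
  le' _ := coordSigma_le _

lemma iSup_coordFiltration :
    ⨆ N, coordFiltration ι 𝓧 N = MeasurableSpace.pi := by
  refine le_antisymm (iSup_le fun N => coordSigma_le _) ?_
  refine iSup_le fun k => ?_
  refine le_trans ?_ (le_iSup _ (Encodable.encode k + 1))
  have hk : k ∈ firstIndices ι (Encodable.encode k + 1) := Nat.lt_succ_self _
  have : (fun x : ι → 𝓧 => x k) = (fun y : firstIndices ι (Encodable.encode k + 1) → 𝓧 =>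
      y ⟨k, hk⟩) ∘ (fun (x : ι → 𝓧) (l : firstIndices ι (Encodable.encode k + 1)) => x l) := rfl
  change MeasurableSpace.comap (fun x : ι → 𝓧 => x k) _ ≤ coordSigma 𝓧 _
  rw [this, ← MeasurableSpace.comap_comp]
  refine MeasurableSpace.comap_mono (Measurable.comap_le ?_)
  fun_prop

/-- Lévy's upward theorem for the successive partial means. -/
lemma tendsto_partialMean {f : (ι → 𝓧) → ℝ} (hf : Measurable f)
    (hfi : Integrable f (Measure.infinitePi ν)) :
    ∀ᵐ x ∂(Measure.infinitePi ν),
      Tendsto (fun N => partialMean ν (firstIndices ι N) f x) atTop (nhds (f x)) := by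
  have h1 := hfi.tendsto_ae_condExp (ℱ := coordFiltration ι 𝓧)
    (by rw [iSup_coordFiltration]; exact hf.stronglyMeasurable)
  have h2 : ∀ᵐ x ∂(Measure.infinitePi ν), ∀ N, partialMean ν (firstIndices ι N) f x =
      ((Measure.infinitePi ν)[f | coordFiltration ι 𝓧 N]) x :=
    ae_all_iff.2 fun N => partialMean_ae_eq_condExp _ hf hfi
  filter_upwards [h1, h2] with x h1 h2
  simpa only [h2] using h1

/-- The martingale increments of the partial means are controlled by the influences. -/
lemma lpNorm_partialMean_sub_sq_le {p : ℝ} (hp : 2 ≤ p) {f : (ι → 𝓧) → ℝ} (hf : Measurable f)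
    (hfp : MemLp f (ENNReal.ofReal p) (Measure.infinitePi ν)) {D : ι → ℝ} (hD0 : ∀ k, 0 ≤ D k)
    (hD : ∀ k, influence ν p f k ≤ ENNReal.ofReal (D k)) (N j : ℕ) :
    lpNorm (partialMean ν (firstIndices ι (N + j)) f - partialMean ν (firstIndices ι N) f)
      (ENNReal.ofReal p) (Measure.infinitePi ν) ^ 2 ≤
      smoothConst p * ∑ i ∈ Finset.range j, D (Denumerable.ofNat ι (N + i)) ^ 2 := by
  have hp1 : 1 ≤ p := by linarith
  have hfi := hfp.integrable (one_le_ofReal hp1)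
  have hmem := fun N => memLp_partialMean (ν := ν) hp1 (firstIndices ι N) hf hfp
  induction j with
  | zero => simp
  | succ j ih =>
    have hsplit : partialMean ν (firstIndices ι (N + (j + 1))) f -
        partialMean ν (firstIndices ι N) f =
        (partialMean ν (firstIndices ι (N + j)) f - partialMean ν (firstIndices ι N) f) +
        (partialMean ν (firstIndices ι (N + j + 1)) f -
          partialMean ν (firstIndices ι (N + j)) f) := by
      rw [← add_assoc]; abel
    have hsm : StronglyMeasurable[coordSigma 𝓧 (firstIndices ι (N + j))]
        (partialMean ν (firstIndices ι (N + j)) f - partialMean ν (firstIndices ι N) f) :=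
      (stronglyMeasurable_partialMean _ hf).sub ((stronglyMeasurable_partialMean _ hf).mono
        (coordSigma_mono (firstIndices_mono (Nat.le_add_right _ _))))
    have hstep := lpNorm_add_sq_le hp (coordSigma_le _) ((hmem (N + j)).sub (hmem N)) hsm
      ((hmem (N + j + 1)).sub (hmem (N + j)))
      (condExp_partialMean_sub (firstIndices_mono (Nat.le_succ _)) hf hfi)
    have hinc : lpNorm (partialMean ν (firstIndices ι (N + j + 1)) f -
        partialMean ν (firstIndices ι (N + j)) f) (ENNReal.ofReal p) (Measure.infinitePi ν) ≤
        D (Denumerable.ofNat ι (N + j)) := by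
      refine lpNorm_le_of_eLpNorm_le ((hmem (N + j + 1)).sub (hmem (N + j))) (hD0 _) ?_
      exact (eLpNorm_partialMean_sub_le hp1 (firstIndices_succ _)
        (ofNat_notMem_firstIndices _) hf hfi).trans (hD _)
    have hc : 0 ≤ smoothConst p := by linarith [one_le_smoothConst hp]
    rw [hsplit, Finset.sum_range_succ, mul_add]
    refine hstep.trans (add_le_add ih ?_)
    gcongr
    exact lpNorm_nonneg

/-- The remainder after revealing the first `N` coordinates is controlled by the square sum of the
remaining influences; Fatou's lemma passes to the limit of the partial means. -/
lemma eLpNorm_sub_partialMean_le {p : ℝ} (hp : 2 ≤ p) {f : (ι → 𝓧) → ℝ} (hf : Measurable f)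
    (hfp : MemLp f (ENNReal.ofReal p) (Measure.infinitePi ν)) {D : ι → ℝ} (hD0 : ∀ k, 0 ≤ D k)
    (hD : ∀ k, influence ν p f k ≤ ENNReal.ofReal (D k)) (N : ℕ) {R : ℝ}
    (hR : ∀ j, smoothConst p * ∑ i ∈ Finset.range j, D (Denumerable.ofNat ι (N + i)) ^ 2 ≤ R) :
    eLpNorm (f - partialMean ν (firstIndices ι N) f)
      (ENNReal.ofReal p) (Measure.infinitePi ν) ≤ ENNReal.ofReal √R := by
  have hp1 : 1 ≤ p := by linarith
  have hfi := hfp.integrable (one_le_ofReal hp1)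
  have hmem := fun N => memLp_partialMean (ν := ν) hp1 (firstIndices ι N) hf hfp
  refine Lp.eLpNorm_le_of_ae_tendsto (u := atTop)
    (f := fun j => partialMean ν (firstIndices ι (N + j)) f - partialMean ν (firstIndices ι N) f)
    (Eventually.of_forall fun j => ?_) (fun j => ((hmem _).sub (hmem _)).1) ?_
  · refine eLpNorm_le_ofReal_of_lpNorm_le ((hmem _).sub (hmem _)) ?_
    refine Real.le_sqrt_of_sq_le ?_
    exact (lpNorm_partialMean_sub_sq_le hp hf hfp hD0 hD N j).trans (hR j)
  · filter_upwards [tendsto_partialMean hf hfi] with x hx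
    have : Tendsto (fun j => partialMean ν (firstIndices ι (N + j)) f x) atTop (nhds (f x)) := by
      simp_rw [add_comm N]
      exact (tendsto_add_atTop_iff_nat N).2 hx
    exact this.sub_const _

/-- **Efron–Stein inequality in `Lᵖ`**, `p ≥ 2`: the deviation of a function of independent
variables from its mean is controlled by the square sum of its influences. -/
lemma eLpNorm_sub_integral_le {p : ℝ} (hp : 2 ≤ p) {f : (ι → 𝓧) → ℝ} (hf : Measurable f)
    (hfp : MemLp f (ENNReal.ofReal p) (Measure.infinitePi ν)) {D : ι → ℝ} (hD0 : ∀ k, 0 ≤ D k)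
    (hD : ∀ k, influence ν p f k ≤ ENNReal.ofReal (D k)) {R : ℝ} (hR0 : 0 ≤ R)
    (hR : ∀ s : Finset ι, ∑ k ∈ s, D k ^ 2 ≤ R ^ 2) :
    eLpNorm (fun x => f x - ∫ y, f y ∂(Measure.infinitePi ν))
      (ENNReal.ofReal p) (Measure.infinitePi ν) ≤ ENNReal.ofReal (√(smoothConst p) * R) := by
  have hc : 0 ≤ smoothConst p := by linarith [one_le_smoothConst hp]
  have h := eLpNorm_sub_partialMean_le hp hf hfp hD0 hD 0 (R := smoothConst p * R ^ 2) fun j => by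
    gcongr
    have := hR ((Finset.range j).map (Denumerable.eqv ι).symm.toEmbedding)
    rw [Finset.sum_map] at this
    simp only [zero_add]
    exact this
  rw [Real.sqrt_mul hc, Real.sqrt_sq hR0] at h
  refine le_trans (le_of_eq ?_) h
  congr 1
  funext x
  simp [firstIndices_zero, partialMean_empty]

/-- **Covariance inequality**: the covariance of two functions of independent variables is at most
the sum of the products of their `L²` influences. -/
lemma abs_integral_mul_sub_le {f g : (ι → 𝓧) → ℝ} (hf : Measurable f) (hg : Measurable g)
    (hfp : MemLp f (ENNReal.ofReal 2) (Measure.infinitePi ν))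
    (hgp : MemLp g (ENNReal.ofReal 2) (Measure.infinitePi ν))
    {D E : ι → ℝ} (hD0 : ∀ k, 0 ≤ D k) (hE0 : ∀ k, 0 ≤ E k)
    (hD : ∀ k, influence ν 2 f k ≤ ENNReal.ofReal (D k))
    (hE : ∀ k, influence ν 2 g k ≤ ENNReal.ofReal (E k))
    (hDs : Summable fun k => D k ^ 2) (hEs : Summable fun k => E k ^ 2) :
    |∫ x, f x * g x ∂(Measure.infinitePi ν) -
      (∫ x, f x ∂(Measure.infinitePi ν)) * ∫ x, g x ∂(Measure.infinitePi ν)| ≤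
      ∑' k, D k * E k := by
  set μ := Measure.infinitePi ν
  have hfi := hfp.integrable (one_le_ofReal one_le_two)
  have hgi := hgp.integrable (one_le_ofReal one_le_two)
  set F : ℕ → (ι → 𝓧) → ℝ := fun N => partialMean ν (firstIndices ι N) f with hF
  set G : ℕ → (ι → 𝓧) → ℝ := fun N => partialMean ν (firstIndices ι N) g with hG
  have hFm : ∀ N, MemLp (F N) (ENNReal.ofReal 2) μ :=
    fun N => memLp_partialMean one_le_two _ hf hfp
  have hGm : ∀ N, MemLp (G N) (ENNReal.ofReal 2) μ :=
    fun N => memLp_partialMean one_le_two _ hg hgp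
  have hsum : Summable fun k => D k * E k := by
    refine Summable.of_nonneg_of_le (fun k => mul_nonneg (hD0 k) (hE0 k)) (fun k => ?_)
      (hDs.add hEs)
    nlinarith [sq_nonneg (D k - E k), sq_nonneg (D k), sq_nonneg (E k)]
  have hDn : ∀ N, lpNorm (F (N + 1) - F N) (ENNReal.ofReal 2) μ ≤ D (Denumerable.ofNat ι N) :=
    fun N => lpNorm_le_of_eLpNorm_le ((hFm _).sub (hFm _)) (hD0 _)
      ((eLpNorm_partialMean_sub_le one_le_two (firstIndices_succ _)
        (ofNat_notMem_firstIndices _) hf hfi).trans (hD _))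
  have hEn : ∀ N, lpNorm (G (N + 1) - G N) (ENNReal.ofReal 2) μ ≤ E (Denumerable.ofNat ι N) :=
    fun N => lpNorm_le_of_eLpNorm_le ((hGm _).sub (hGm _)) (hE0 _)
      ((eLpNorm_partialMean_sub_le one_le_two (firstIndices_succ _)
        (ofNat_notMem_firstIndices _) hg hgi).trans (hE _))
  -- orthogonality of the increments
  have hstep : ∀ N, ∫ x, F N x * G N x ∂μ = (∫ x, f x ∂μ) * (∫ x, g x ∂μ) +
      ∑ i ∈ Finset.range N, ∫ x, (F (i + 1) - F i) x * (G (i + 1) - G i) x ∂μ := by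
    intro N
    induction N with
    | zero => simp [hF, hG, firstIndices_zero, partialMean_empty, μ]
    | succ N ih =>
      have h1 : ∫ x, F N x * (G (N + 1) - G N) x ∂μ = 0 :=
        integral_mul_eq_zero_of_condExp (coordSigma_le _) (hFm N)
          (stronglyMeasurable_partialMean _ hf) ((hGm _).sub (hGm _))
          (condExp_partialMean_sub (firstIndices_mono (Nat.le_succ _)) hg hgi)
      have h2 : ∫ x, G N x * (F (N + 1) - F N) x ∂μ = 0 :=
        integral_mul_eq_zero_of_condExp (coordSigma_le _) (hGm N)
          (stronglyMeasurable_partialMean _ hg) ((hFm _).sub (hFm _))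
          (condExp_partialMean_sub (firstIndices_mono (Nat.le_succ _)) hf hfi)
      have i1 := integrable_mul_of_memLp_two (hFm N) (hGm N)
      have i2 := integrable_mul_of_memLp_two (hFm N) ((hGm (N + 1)).sub (hGm N))
      have i3 := integrable_mul_of_memLp_two (hGm N) ((hFm (N + 1)).sub (hFm N))
      have i4 := integrable_mul_of_memLp_two ((hFm (N + 1)).sub (hFm N))
        ((hGm (N + 1)).sub (hGm N))
      have e : ∫ x, F (N + 1) x * G (N + 1) x ∂μ = ∫ x, (F N x * G N x +
          F N x * (G (N + 1) - G N) x + G N x * (F (N + 1) - F N) x +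
          (F (N + 1) - F N) x * (G (N + 1) - G N) x) ∂μ := by
        congr 1 with x
        simp only [Pi.sub_apply]; ring
      have e1 := integral_add i1 i2
      have e2 := integral_add (i1.add i2) i3
      have e3 := integral_add ((i1.add i2).add i3) i4
      simp only [Pi.add_apply] at e1 e2 e3
      rw [e, e3, e2, e1, h1, h2, ih, Finset.sum_range_succ]
      ring
  have hbound : ∀ N, |∫ x, F N x * G N x ∂μ - (∫ x, f x ∂μ) * (∫ x, g x ∂μ)| ≤
      ∑' k, D k * E k := by
    intro N
    rw [hstep, add_sub_cancel_left]
    calc |∑ i ∈ Finset.range N, ∫ x, (F (i + 1) - F i) x * (G (i + 1) - G i) x ∂μ|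
        ≤ ∑ i ∈ Finset.range N, |∫ x, (F (i + 1) - F i) x * (G (i + 1) - G i) x ∂μ| :=
          Finset.abs_sum_le_sum_abs _ _
      _ ≤ ∑ i ∈ Finset.range N, D (Denumerable.ofNat ι i) * E (Denumerable.ofNat ι i) := by
          refine Finset.sum_le_sum fun i _ => (abs_integral_mul_le ((hFm _).sub (hFm _))
            ((hGm _).sub (hGm _))).trans ?_
          exact mul_le_mul (hDn i) (hEn i) lpNorm_nonneg (hD0 _)
      _ = ∑ k ∈ (Finset.range N).map (Denumerable.eqv ι).symm.toEmbedding, D k * E k := by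
          rw [Finset.sum_map]; rfl
      _ ≤ _ := hsum.sum_le_tsum _ fun k _ => mul_nonneg (hD0 k) (hE0 k)
  -- the partial means converge in `L²`, because the tails of the square sums vanish
  have hconv : ∀ {h : (ι → 𝓧) → ℝ} {A : ι → ℝ}, Measurable h →
      MemLp h (ENNReal.ofReal 2) μ → (∀ k, 0 ≤ A k) →
      (∀ k, influence ν 2 h k ≤ ENNReal.ofReal (A k)) → (Summable fun k => A k ^ 2) →
      Tendsto (fun N => lpNorm (h - partialMean ν (firstIndices ι N) h) (ENNReal.ofReal 2) μ)
        atTop (nhds 0) := by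
    intro h A hh hhp hA0 hA hAs
    have hAs' : Summable fun i => A (Denumerable.ofNat ι i) ^ 2 :=
      hAs.comp_injective (Denumerable.eqv ι).symm.injective
    have htail : Tendsto (fun N => √(smoothConst 2 * ∑' i, A (Denumerable.ofNat ι (i + N)) ^ 2))
        atTop (nhds 0) := by
      have := (tendsto_sum_nat_add fun i => A (Denumerable.ofNat ι i) ^ 2).const_mul (smoothConst 2)
      rw [mul_zero] at this
      have h := (Real.continuous_sqrt.tendsto 0).comp this
      rwa [Real.sqrt_zero] at h
    refine squeeze_zero (fun _ => lpNorm_nonneg) (fun N => ?_) htail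
    refine lpNorm_le_of_eLpNorm_le (hhp.sub (memLp_partialMean one_le_two _ hh hhp))
      (Real.sqrt_nonneg _) ?_
    refine eLpNorm_sub_partialMean_le le_rfl hh hhp hA0 hA N fun j => ?_
    have hc : 0 ≤ smoothConst 2 := by linarith [one_le_smoothConst (le_refl 2)]
    gcongr
    simp_rw [add_comm N]
    exact ((summable_nat_add_iff (f := fun i => A (Denumerable.ofNat ι i) ^ 2) N).2
      hAs').sum_le_tsum _ fun _ _ => sq_nonneg _
  have hlim : Tendsto (fun N => ∫ x, F N x * G N x ∂μ) atTop (nhds (∫ x, f x * g x ∂μ)) := by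
    rw [tendsto_iff_dist_tendsto_zero]
    have h1 := ((hconv hf hfp hD0 hD hDs).mul_const (lpNorm g (ENNReal.ofReal 2) μ)).add
      ((hconv hg hgp hE0 hE hEs).const_mul (lpNorm f (ENNReal.ofReal 2) μ))
    simp only [zero_mul, mul_zero, add_zero] at h1
    refine squeeze_zero (fun _ => dist_nonneg) (fun N => ?_) h1
    have i1 := integrable_mul_of_memLp_two (hfp.sub (hFm N)) (hGm N)
    have i2 := integrable_mul_of_memLp_two hfp (hgp.sub (hGm N))
    have e : ∫ x, f x * g x ∂μ - ∫ x, F N x * G N x ∂μ =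
        ∫ x, (f - F N) x * G N x ∂μ + ∫ x, f x * (g - G N) x ∂μ := by
      rw [← integral_sub (integrable_mul_of_memLp_two hfp hgp)
        (integrable_mul_of_memLp_two (hFm N) (hGm N)), ← integral_add i1 i2]
      congr 1 with x
      simp only [Pi.sub_apply]; ring
    rw [dist_comm, Real.dist_eq, e]
    refine (abs_add_le _ _).trans (add_le_add ?_ ?_)
    · refine (abs_integral_mul_le (hfp.sub (hFm N)) (hGm N)).trans ?_
      gcongr
      · exact lpNorm_nonneg
      · exact lpNorm_partialMean_le one_le_two _ hg hgp
    · exact abs_integral_mul_le hfp (hgp.sub (hGm N))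
  exact le_of_tendsto ((hlim.sub_const _).abs) (Eventually.of_forall hbound)

end Influence

/-! ### Convolution inequalities -/

section Convolution

variable {ι : Type*} [AddCommGroup ι]

/-- The convolution `r ↦ ∑_k |c_k| w_{r-k}` of finitely supported weights with a sequence. -/
def absConv (I : Finset ι) (c w : ι → ℝ) (r : ι) : ℝ := ∑ k ∈ I, |c k| * w (r - k)

lemma absConv_nonneg {I : Finset ι} {c w : ι → ℝ} (hw : ∀ k, 0 ≤ w k) (r : ι) :
    0 ≤ absConv I c w r := Finset.sum_nonneg fun _ _ => mul_nonneg (abs_nonneg _) (hw _)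

lemma sum_sub_left_le_tsum {w : ι → ℝ} (hw : ∀ k, 0 ≤ w k) (hws : Summable w) (I : Finset ι)
    (r : ι) : ∑ k ∈ I, w (r - k) ≤ ∑' k, w k := by
  rw [← (Equiv.subLeft r).tsum_eq w]
  exact ((Equiv.subLeft r).summable_iff.2 hws).sum_le_tsum I fun _ _ => hw _

lemma sum_sub_right_le_tsum {w : ι → ℝ} (hw : ∀ k, 0 ≤ w k) (hws : Summable w) (s : Finset ι)
    (k : ι) : ∑ r ∈ s, w (r - k) ≤ ∑' k, w k := by
  rw [← (Equiv.subRight k).tsum_eq w]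
  exact ((Equiv.subRight k).summable_iff.2 hws).sum_le_tsum s fun _ _ => hw _

/-- **Young's inequality** `‖c * w‖₂ ≤ ‖c‖₂ ‖w‖₁`. -/
lemma sum_absConv_sq_le {w : ι → ℝ} (hw : ∀ k, 0 ≤ w k) (hws : Summable w) (I s : Finset ι)
    (c : ι → ℝ) : ∑ r ∈ s, absConv I c w r ^ 2 ≤ (∑' k, w k) ^ 2 * ∑ k ∈ I, c k ^ 2 := by
  have hW : 0 ≤ ∑' k, w k := tsum_nonneg hw
  calc ∑ r ∈ s, absConv I c w r ^ 2
      ≤ ∑ r ∈ s, (∑' k, w k) * ∑ k ∈ I, c k ^ 2 * w (r - k) := by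
        refine Finset.sum_le_sum fun r _ => ?_
        refine (Finset.sum_sq_le_sum_mul_sum_of_sq_le_mul I (f := fun k => w (r - k))
          (g := fun k => c k ^ 2 * w (r - k)) (fun k _ => hw _)
          (fun k _ => mul_nonneg (sq_nonneg _) (hw _)) fun k _ => le_of_eq ?_).trans ?_
        · rw [mul_pow, sq_abs]; ring
        · refine mul_le_mul_of_nonneg_right (sum_sub_left_le_tsum hw hws I r) ?_
          exact Finset.sum_nonneg fun k _ => mul_nonneg (sq_nonneg _) (hw _)
    _ = (∑' k, w k) * ∑ k ∈ I, c k ^ 2 * ∑ r ∈ s, w (r - k) := by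
        rw [← Finset.mul_sum, Finset.sum_comm]
        simp_rw [Finset.mul_sum]
    _ ≤ (∑' k, w k) * ∑ k ∈ I, c k ^ 2 * ∑' k, w k := by
        gcongr with k
        exact sum_sub_right_le_tsum hw hws s k
    _ = _ := by rw [← Finset.sum_mul]; ring

lemma tsum_absConv_mul_le {w : ι → ℝ} (hw : ∀ k, 0 ≤ w k) (hws : Summable w) (I : Finset ι)
    {c d : ι → ℝ} (hc : ∑ k ∈ I, c k ^ 2 ≤ 1) (hd : ∑ k ∈ I, d k ^ 2 ≤ 1) :
    ∑' r, absConv I c w r * absConv I d w r ≤ (∑' k, w k) ^ 2 := by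
  refine Real.tsum_le_of_sum_le
    (fun r => mul_nonneg (absConv_nonneg hw r) (absConv_nonneg hw r)) fun s => ?_
  have h1 := sum_absConv_sq_le hw hws I s c
  have h2 := sum_absConv_sq_le hw hws I s d
  have hW : 0 ≤ (∑' k, w k) ^ 2 := sq_nonneg _
  calc ∑ r ∈ s, absConv I c w r * absConv I d w r
      ≤ ∑ r ∈ s, (absConv I c w r ^ 2 + absConv I d w r ^ 2) / 2 := by
        refine Finset.sum_le_sum fun r _ => ?_
        nlinarith [sq_nonneg (absConv I c w r - absConv I d w r)]
    _ = (∑ r ∈ s, absConv I c w r ^ 2 + ∑ r ∈ s, absConv I d w r ^ 2) / 2 := by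
        rw [← Finset.sum_add_distrib, Finset.sum_div]
    _ ≤ _ := by nlinarith

end Convolution

/-! ### Quadratic forms in functionals of independent variables -/

section Quadratic

variable {ι 𝓧 : Type*} [MeasurableSpace 𝓧] {ν : ι → Measure 𝓧}

lemma influence_eq [DecidableEq ι] (p : ℝ) (f : (ι → 𝓧) → ℝ) (k : ι) :
    influence ν p f k =
      eLpNorm (fun z : (ι → 𝓧) × (ι → 𝓧) => f z.1 - f (Function.update z.1 k (z.2 k)))
        (ENNReal.ofReal p) ((Measure.infinitePi ν).prod (Measure.infinitePi ν)) := by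
  unfold influence
  congr!

lemma influence_sum_mul_le {M : ℝ} (hM : 2 ≤ M) {κ : Type*} (J : Finset κ) (a : κ → ℝ)
    {f : κ → (ι → 𝓧) → ℝ} (r : ι) (hf : ∀ t ∈ J, Measurable (f t)) {D : κ → ℝ}
    (hD0 : ∀ t ∈ J, 0 ≤ D t)
    (hD : ∀ t ∈ J, influence ν (M / 2) (f t) r ≤ ENNReal.ofReal (D t)) :
    influence ν (M / 2) (fun x => ∑ t ∈ J, a t * f t x) r ≤
      ENNReal.ofReal (∑ t ∈ J, |a t| * D t) := by
  classical
  have hu := measurable_update_copy (𝓧 := 𝓧) r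
  simp only [influence_eq] at hD ⊢
  have e : (fun z : (ι → 𝓧) × (ι → 𝓧) => ∑ t ∈ J, a t * f t z.1 -
      ∑ t ∈ J, a t * f t (Function.update z.1 r (z.2 r))) =
      ∑ t ∈ J, a t • fun z : (ι → 𝓧) × (ι → 𝓧) =>
        f t z.1 - f t (Function.update z.1 r (z.2 r)) := by
    funext z
    simp only [Finset.sum_apply, Pi.smul_apply, smul_eq_mul, mul_sub, Finset.sum_sub_distrib]
  rw [ENNReal.ofReal_sum_of_nonneg fun t ht => mul_nonneg (abs_nonneg _) (hD0 t ht)]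
  rw [e]
  refine (eLpNorm_sum_le (fun t ht => ?_) (one_le_ofReal ?_)).trans
    (Finset.sum_le_sum fun t ht => ?_)
  · exact ((((hf t ht).comp measurable_fst).sub ((hf t ht).comp hu)).const_smul
      (a t)).aestronglyMeasurable
  · linarith
  · rw [eLpNorm_const_smul, ENNReal.ofReal_mul (abs_nonneg _), Real.enorm_eq_ofReal_abs]
    gcongr
    exact hD t ht

variable [∀ k, IsProbabilityMeasure (ν k)]

lemma holderTriple_half {M : ℝ} (hM : 0 < M) :
    ENNReal.HolderTriple (ENNReal.ofReal M) (ENNReal.ofReal M) (ENNReal.ofReal (M / 2)) :=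
  Real.HolderTriple.ennrealOfReal ⟨by field_simp; norm_num, hM, hM⟩

lemma eLpNorm_mul_half_le {α : Type*} [MeasurableSpace α] {μ : Measure α} {M : ℝ} (hM : 0 < M)
    {X Y : α → ℝ} (hX : AEStronglyMeasurable X μ) (hY : AEStronglyMeasurable Y μ) :
    eLpNorm (fun x => X x * Y x) (ENNReal.ofReal (M / 2)) μ ≤
      eLpNorm X (ENNReal.ofReal M) μ * eLpNorm Y (ENNReal.ofReal M) μ := by
  have := holderTriple_half hM
  exact eLpNorm_smul_le_mul_eLpNorm (p := ENNReal.ofReal M) (q := ENNReal.ofReal M)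
    (r := ENNReal.ofReal (M / 2)) (φ := X) (f := Y) hY hX

/-- Replacing one coordinate by an independent copy preserves the law. -/
lemma measurePreserving_update_copy [DecidableEq ι] (k : ι) :
    MeasurePreserving (fun z : (ι → 𝓧) × (ι → 𝓧) => Function.update z.1 k (z.2 k))
      ((Measure.infinitePi ν).prod (Measure.infinitePi ν)) (Measure.infinitePi ν) := by
  convert measurePreserving_fst_exchange ν ({k}ᶜ : Set ι) using 1
  funext z l
  by_cases hl : l = k
  · subst hl; simp [exchange]
  · simp [exchange, hl]

lemma influence_mono {p q : ℝ} (hpq : p ≤ q) {f : (ι → 𝓧) → ℝ} (hf : Measurable f) (k : ι) :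
    influence ν p f k ≤ influence ν q f k := by
  classical
  unfold influence
  refine eLpNorm_le_eLpNorm_of_exponent_le (ENNReal.ofReal_le_ofReal hpq) ?_
  exact ((hf.comp measurable_fst).sub (hf.comp (measurable_update_copy k))).aestronglyMeasurable

/-- The influences of a product, by Hölder's inequality. -/
lemma eLpNorm_mul_sub_mul_update_le [DecidableEq ι] {M : ℝ} (hM : 2 ≤ M) {f g : (ι → 𝓧) → ℝ}
    (hf : Measurable f) (hg : Measurable g) {A a b : ℝ} (hA : 0 ≤ A) (ha : 0 ≤ a) (hb : 0 ≤ b)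
    (hfA : eLpNorm f (ENNReal.ofReal M) (Measure.infinitePi ν) ≤ ENNReal.ofReal A)
    (hgA : eLpNorm g (ENNReal.ofReal M) (Measure.infinitePi ν) ≤ ENNReal.ofReal A) {r : ι}
    (hfa : influence ν M f r ≤ ENNReal.ofReal (A * a))
    (hgb : influence ν M g r ≤ ENNReal.ofReal (A * b)) :
    eLpNorm (fun z : (ι → 𝓧) × (ι → 𝓧) => f z.1 * g z.1 -
      f (Function.update z.1 r (z.2 r)) * g (Function.update z.1 r (z.2 r)))
      (ENNReal.ofReal (M / 2)) ((Measure.infinitePi ν).prod (Measure.infinitePi ν)) ≤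
      ENNReal.ofReal (A ^ 2 * (a + b)) := by
  set μ := Measure.infinitePi ν
  have hM0 : 0 < M := by linarith
  have hu := measurable_update_copy (𝓧 := 𝓧) r
  have hf1 : Measurable fun z : (ι → 𝓧) × (ι → 𝓧) => f z.1 := hf.comp measurable_fst
  have hg1 : Measurable fun z : (ι → 𝓧) × (ι → 𝓧) => g z.1 := hg.comp measurable_fst
  have hf2 : Measurable fun z : (ι → 𝓧) × (ι → 𝓧) => f (Function.update z.1 r (z.2 r)) :=
    hf.comp hu
  have hg2 : Measurable fun z : (ι → 𝓧) × (ι → 𝓧) => g (Function.update z.1 r (z.2 r)) :=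
    hg.comp hu
  have e : (fun z : (ι → 𝓧) × (ι → 𝓧) => f z.1 * g z.1 -
      f (Function.update z.1 r (z.2 r)) * g (Function.update z.1 r (z.2 r))) =
      (fun z => (f z.1 - f (Function.update z.1 r (z.2 r))) * g z.1) +
      fun z => f (Function.update z.1 r (z.2 r)) *
        (g z.1 - g (Function.update z.1 r (z.2 r))) := by
    funext z; simp only [Pi.add_apply]; ring
  have n1 : eLpNorm (fun z : (ι → 𝓧) × (ι → 𝓧) => g z.1) (ENNReal.ofReal M) (μ.prod μ) ≤
      ENNReal.ofReal A := by
    refine le_trans (le_of_eq ?_) hgA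
    exact eLpNorm_comp_measurePreserving (g := g) hg.aestronglyMeasurable measurePreserving_fst
  have n2 : eLpNorm (fun z : (ι → 𝓧) × (ι → 𝓧) => f (Function.update z.1 r (z.2 r)))
      (ENNReal.ofReal M) (μ.prod μ) ≤ ENNReal.ofReal A := by
    refine le_trans (le_of_eq ?_) hfA
    exact eLpNorm_comp_measurePreserving (g := f) hf.aestronglyMeasurable
      (measurePreserving_update_copy r)
  have n3 : eLpNorm (fun z : (ι → 𝓧) × (ι → 𝓧) => f z.1 - f (Function.update z.1 r (z.2 r)))
      (ENNReal.ofReal M) (μ.prod μ) ≤ ENNReal.ofReal (A * a) := by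
    rwa [influence_eq] at hfa
  have n4 : eLpNorm (fun z : (ι → 𝓧) × (ι → 𝓧) => g z.1 - g (Function.update z.1 r (z.2 r)))
      (ENNReal.ofReal M) (μ.prod μ) ≤ ENNReal.ofReal (A * b) := by
    rwa [influence_eq] at hgb
  rw [e]
  refine (eLpNorm_add_le ((hf1.sub hf2).mul hg1).aestronglyMeasurable
    (hf2.mul (hg1.sub hg2)).aestronglyMeasurable (one_le_ofReal (by linarith))).trans ?_
  have m1 := eLpNorm_mul_half_le (μ := μ.prod μ) hM0 (hf1.sub hf2).aestronglyMeasurable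
    hg1.aestronglyMeasurable
  have m2 := eLpNorm_mul_half_le (μ := μ.prod μ) hM0 hf2.aestronglyMeasurable
    (hg1.sub hg2).aestronglyMeasurable
  calc _ ≤ ENNReal.ofReal (A * a) * ENNReal.ofReal A +
        ENNReal.ofReal A * ENNReal.ofReal (A * b) :=
        add_le_add (m1.trans (mul_le_mul' n3 n1)) (m2.trans (mul_le_mul' n2 n4))
    _ = ENNReal.ofReal (A ^ 2 * (a + b)) := by
        rw [← ENNReal.ofReal_mul (by positivity), ← ENNReal.ofReal_mul hA,
          ← ENNReal.ofReal_add (by positivity) (by positivity)]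
        congr 1; ring

variable [AddCommGroup ι] [Denumerable ι]

/-- The deviation of a kernel-weighted quadratic form from its mean. The weights `w` bound the
influences of the functionals `g`, `b` bounds the coefficients and `L` the row and column sums of
the kernel. -/
lemma eLpNorm_quadratic_sub_integral_le {M : ℝ} (hM : 4 ≤ M) {I : Finset ι}
    {g : ι → (ι → 𝓧) → ℝ} (hg : ∀ k ∈ I, Measurable (g k)) {A : ℝ} (hA : 0 ≤ A)
    (hgA : ∀ k ∈ I, eLpNorm (g k) (ENNReal.ofReal M) (Measure.infinitePi ν) ≤ ENNReal.ofReal A)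
    {w : ι → ℝ} (hw : ∀ k, 0 ≤ w k) (hws : Summable w)
    (hgw : ∀ k ∈ I, ∀ r, influence ν M (g k) r ≤ ENNReal.ofReal (A * w (r - k)))
    {c d : ι → ℝ} (hc : ∑ k ∈ I, c k ^ 2 ≤ 1) (hd : ∑ k ∈ I, d k ^ 2 ≤ 1) {b L : ℝ} (hb : 0 ≤ b)
    (hL : 0 ≤ L)
    (hcb : ∀ k ∈ I, |c k| ≤ b) (hdb : ∀ k ∈ I, |d k| ≤ b) {θ : ι → ι → ℝ} (hθ : ∀ k l, 0 ≤ θ k l)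
    (hθ1 : ∀ k ∈ I, ∑ l ∈ I, θ k l ≤ L) (hθ2 : ∀ l ∈ I, ∑ k ∈ I, θ k l ≤ L) :
    eLpNorm (fun x => ∑ t ∈ I ×ˢ I, c t.1 * d t.2 * θ t.1 t.2 * (g t.1 x * g t.2 x) -
      ∫ y, ∑ t ∈ I ×ˢ I, c t.1 * d t.2 * θ t.1 t.2 * (g t.1 y * g t.2 y) ∂(Measure.infinitePi ν))
      (ENNReal.ofReal (M / 2)) (Measure.infinitePi ν) ≤
      ENNReal.ofReal (√(smoothConst (M / 2)) * (2 * A ^ 2 * (b * L) * ∑' k, w k)) := by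
  classical
  have hM0 : 0 < M := by linarith
  have := holderTriple_half hM0
  have hgm : ∀ k ∈ I, MemLp (g k) (ENNReal.ofReal M) (Measure.infinitePi ν) := fun k hk =>
    ⟨(hg k hk).aestronglyMeasurable, (hgA k hk).trans_lt ENNReal.ofReal_lt_top⟩
  have hW : 0 ≤ ∑' k, w k := tsum_nonneg hw
  have hfm : ∀ t ∈ I ×ˢ I, Measurable fun x => g t.1 x * g t.2 x := fun t ht =>
    (hg _ (Finset.mem_product.1 ht).1).mul (hg _ (Finset.mem_product.1 ht).2)
  have hn := absConv_nonneg (I := I) (c := c) hw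
  have hn' := absConv_nonneg (I := I) (c := d) hw
  refine eLpNorm_sub_integral_le (by linarith) ?_ ?_
    (D := fun r => A ^ 2 * (b * L) * (absConv I c w r + absConv I d w r)) ?_ ?_
    (by positivity) ?_
  · exact Finset.measurable_fun_sum _ fun t ht => (hfm t ht).const_mul _
  · refine memLp_finsetSum _ fun t ht => MemLp.const_mul ?_ _
    exact (hgm _ (Finset.mem_product.1 ht).2).mul' (hgm _ (Finset.mem_product.1 ht).1)
  · exact fun r => mul_nonneg (by positivity) (add_nonneg (hn r) (hn' r))
  · intro r
    refine (influence_sum_mul_le (by linarith) _ _ r hfm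
      (D := fun t => A ^ 2 * (w (r - t.1) + w (r - t.2)))
      (fun t _ => mul_nonneg (by positivity) (add_nonneg (hw _) (hw _))) fun t ht => ?_).trans
      (ENNReal.ofReal_le_ofReal ?_)
    · have h1 := (Finset.mem_product.1 ht).1
      have h2 := (Finset.mem_product.1 ht).2
      have := eLpNorm_mul_sub_mul_update_le (by linarith) (hg _ h1) (hg _ h2) hA (hw (r - t.1))
        (hw (r - t.2)) (hgA _ h1) (hgA _ h2) (hgw _ h1 r) (hgw _ h2 r)
      rwa [influence_eq]
    · -- the row and column sums of the kernel and the size of the coefficients leave a convolution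
      have s1 : ∑ k ∈ I, ∑ l ∈ I, |c k| * w (r - k) * (b * θ k l) ≤
          absConv I c w r * (b * L) := by
        rw [absConv, Finset.sum_mul]
        refine Finset.sum_le_sum fun k hk => ?_
        rw [← Finset.mul_sum, ← Finset.mul_sum]
        refine mul_le_mul_of_nonneg_left (mul_le_mul_of_nonneg_left (hθ1 k hk) hb) ?_
        exact mul_nonneg (abs_nonneg _) (hw _)
      have s2 : ∑ k ∈ I, ∑ l ∈ I, |d l| * w (r - l) * (b * θ k l) ≤
          absConv I d w r * (b * L) := by
        rw [absConv, Finset.sum_mul, Finset.sum_comm]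
        refine Finset.sum_le_sum fun l hl => ?_
        rw [← Finset.mul_sum, ← Finset.mul_sum]
        refine mul_le_mul_of_nonneg_left (mul_le_mul_of_nonneg_left (hθ2 l hl) hb) ?_
        exact mul_nonneg (abs_nonneg _) (hw _)
      calc ∑ t ∈ I ×ˢ I, |c t.1 * d t.2 * θ t.1 t.2| * (A ^ 2 * (w (r - t.1) + w (r - t.2)))
          ≤ ∑ t ∈ I ×ˢ I, A ^ 2 * (|c t.1| * w (r - t.1) * (b * θ t.1 t.2) +
              |d t.2| * w (r - t.2) * (b * θ t.1 t.2)) := by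
            refine Finset.sum_le_sum fun t ht => ?_
            have h1 := hcb _ (Finset.mem_product.1 ht).1
            have h2 := hdb _ (Finset.mem_product.1 ht).2
            rw [abs_mul, abs_mul, abs_of_nonneg (hθ _ _)]
            have e1 : |c t.1| * w (r - t.1) * (|d t.2| * θ t.1 t.2) ≤
                |c t.1| * w (r - t.1) * (b * θ t.1 t.2) :=
              mul_le_mul_of_nonneg_left (mul_le_mul_of_nonneg_right h2 (hθ _ _))
                (mul_nonneg (abs_nonneg _) (hw _))
            have e2 : |d t.2| * w (r - t.2) * (|c t.1| * θ t.1 t.2) ≤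
                |d t.2| * w (r - t.2) * (b * θ t.1 t.2) :=
              mul_le_mul_of_nonneg_left (mul_le_mul_of_nonneg_right h1 (hθ _ _))
                (mul_nonneg (abs_nonneg _) (hw _))
            calc _ = A ^ 2 * (|c t.1| * w (r - t.1) * (|d t.2| * θ t.1 t.2) +
                  |d t.2| * w (r - t.2) * (|c t.1| * θ t.1 t.2)) := by ring
              _ ≤ _ := by gcongr
        _ = A ^ 2 * (∑ k ∈ I, ∑ l ∈ I, |c k| * w (r - k) * (b * θ k l) +
              ∑ k ∈ I, ∑ l ∈ I, |d l| * w (r - l) * (b * θ k l)) := by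
            rw [← Finset.mul_sum, Finset.sum_add_distrib, Finset.sum_product, Finset.sum_product]
        _ ≤ A ^ 2 * (absConv I c w r * (b * L) + absConv I d w r * (b * L)) := by gcongr
        _ = _ := by ring
  · intro s
    have h1 := sum_absConv_sq_le hw hws I s c
    have h2 := sum_absConv_sq_le hw hws I s d
    have h3 : ∑ r ∈ s, (absConv I c w r + absConv I d w r) ^ 2 ≤ 4 * (∑' k, w k) ^ 2 := by
      calc ∑ r ∈ s, (absConv I c w r + absConv I d w r) ^ 2
          ≤ ∑ r ∈ s, (2 * absConv I c w r ^ 2 + 2 * absConv I d w r ^ 2) := by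
            refine Finset.sum_le_sum fun r _ => ?_
            nlinarith [sq_nonneg (absConv I c w r - absConv I d w r)]
        _ = 2 * ∑ r ∈ s, absConv I c w r ^ 2 + 2 * ∑ r ∈ s, absConv I d w r ^ 2 := by
            rw [Finset.sum_add_distrib, Finset.mul_sum, Finset.mul_sum]
        _ ≤ _ := by nlinarith [sq_nonneg (∑' k, w k)]
    simp_rw [mul_pow _ (absConv I c w _ + absConv I d w _), ← Finset.mul_sum]
    calc _ ≤ (A ^ 2 * (b * L)) ^ 2 * (4 * (∑' k, w k) ^ 2) := by gcongr
      _ = _ := by ring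

/-- The bias of a kernel-weighted quadratic form. The weights `w` bound the influences of the
functionals `g`, and the deviation of the kernel from one turns them into the weights `v`. -/
lemma abs_integral_quadratic_sub_le {M : ℝ} (hM : 4 ≤ M) {I : Finset ι}
    {g : ι → (ι → 𝓧) → ℝ} (hg : ∀ k ∈ I, Measurable (g k)) {A : ℝ} (hA : 0 ≤ A)
    (hgA : ∀ k ∈ I, eLpNorm (g k) (ENNReal.ofReal M) (Measure.infinitePi ν) ≤ ENNReal.ofReal A)
    (hg0 : ∀ k ∈ I, ∫ x, g k x ∂(Measure.infinitePi ν) = 0)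
    {w v : ι → ℝ} (hw : ∀ k, 0 ≤ w k) (hv : ∀ k, 0 ≤ v k) (hws : Summable fun k => w k ^ 2)
    (hvs : Summable v)
    (hgw : ∀ k ∈ I, ∀ r, influence ν M (g k) r ≤ ENNReal.ofReal (A * w (r - k)))
    {c d : ι → ℝ} (hc : ∑ k ∈ I, c k ^ 2 ≤ 1) (hd : ∑ k ∈ I, d k ^ 2 ≤ 1)
    {θ : ι → ι → ℝ} {η : ℝ} (hη : 0 ≤ η)
    (hθ : ∀ k l r, |θ k l - 1| * (w (r - k) * w (r - l)) ≤ η * (v (r - k) * v (r - l))) :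
    |(∫ x, ∑ t ∈ I ×ˢ I, c t.1 * d t.2 * θ t.1 t.2 * (g t.1 x * g t.2 x) ∂(Measure.infinitePi ν)) -
      ∫ x, (∑ k ∈ I, c k * g k x) * ∑ l ∈ I, d l * g l x ∂(Measure.infinitePi ν)| ≤
      A ^ 2 * η * (∑' k, v k) ^ 2 := by
  have hgm : ∀ k ∈ I, MemLp (g k) (ENNReal.ofReal 2) (Measure.infinitePi ν) := fun k hk =>
    MemLp.mono_exponent ⟨(hg k hk).aestronglyMeasurable,
      (hgA k hk).trans_lt ENNReal.ofReal_lt_top⟩ (ENNReal.ofReal_le_ofReal (by linarith))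
  have hint : ∀ t ∈ I ×ˢ I, Integrable (fun x => g t.1 x * g t.2 x) (Measure.infinitePi ν) :=
    fun t ht => integrable_mul_of_memLp_two (hgm _ (Finset.mem_product.1 ht).1)
      (hgm _ (Finset.mem_product.1 ht).2)
  have e1 : ∫ x, ∑ t ∈ I ×ˢ I, c t.1 * d t.2 * θ t.1 t.2 * (g t.1 x * g t.2 x)
      ∂(Measure.infinitePi ν) = ∑ t ∈ I ×ˢ I, c t.1 * d t.2 * θ t.1 t.2 *
        ∫ x, g t.1 x * g t.2 x ∂(Measure.infinitePi ν) := by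
    rw [integral_finsetSum _ fun t ht => (hint t ht).const_mul _]
    simp_rw [integral_const_mul]
  have e2 : ∫ x, (∑ k ∈ I, c k * g k x) * ∑ l ∈ I, d l * g l x ∂(Measure.infinitePi ν) =
      ∑ t ∈ I ×ˢ I, c t.1 * d t.2 * ∫ x, g t.1 x * g t.2 x ∂(Measure.infinitePi ν) := by
    have : ∀ x, (∑ k ∈ I, c k * g k x) * ∑ l ∈ I, d l * g l x =
        ∑ t ∈ I ×ˢ I, c t.1 * d t.2 * (g t.1 x * g t.2 x) := by
      intro x
      rw [Finset.sum_mul_sum, ← Finset.sum_product']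
      exact Finset.sum_congr rfl fun t _ => by ring
    simp_rw [this]
    rw [integral_finsetSum _ fun t ht => (hint t ht).const_mul _]
    simp_rw [integral_const_mul]
  have hww : ∀ k l, Summable fun r => w (r - k) * w (r - l) := by
    intro k l
    refine Summable.of_nonneg_of_le (fun r => mul_nonneg (hw _) (hw _)) (fun r => ?_)
      (((Equiv.subRight k).summable_iff.2 hws).add ((Equiv.subRight l).summable_iff.2 hws))
    simp only [Function.comp, Equiv.subRight_apply]
    nlinarith [sq_nonneg (w (r - k) - w (r - l)), sq_nonneg (w (r - k)), sq_nonneg (w (r - l))]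
  have hvb : ∀ l, v l ≤ ∑' k, v k := fun l => hvs.le_tsum l fun _ _ => hv _
  have hvv : ∀ k l, Summable fun r => v (r - k) * v (r - l) := by
    intro k l
    refine Summable.of_nonneg_of_le (fun r => mul_nonneg (hv _) (hv _)) (fun r => ?_)
      (((Equiv.subRight k).summable_iff.2 hvs).mul_right (∑' k, v k))
    exact mul_le_mul_of_nonneg_left (hvb _) (hv _)
  have hcov : ∀ t ∈ I ×ˢ I, |∫ x, g t.1 x * g t.2 x ∂(Measure.infinitePi ν)| ≤
      A ^ 2 * ∑' r, w (r - t.1) * w (r - t.2) := by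
    intro t ht
    have h1 := (Finset.mem_product.1 ht).1
    have h2 := (Finset.mem_product.1 ht).2
    have := abs_integral_mul_sub_le (hg _ h1) (hg _ h2) (hgm _ h1) (hgm _ h2)
      (D := fun r => A * w (r - t.1)) (E := fun r => A * w (r - t.2))
      (fun r => mul_nonneg hA (hw _)) (fun r => mul_nonneg hA (hw _))
      (fun r => (influence_mono (by linarith) (hg _ h1) r).trans (hgw _ h1 r))
      (fun r => (influence_mono (by linarith) (hg _ h2) r).trans (hgw _ h2 r))
      (by simp_rw [mul_pow]; exact ((Equiv.subRight t.1).summable_iff.2 hws).mul_left _)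
      (by simp_rw [mul_pow]; exact ((Equiv.subRight t.2).summable_iff.2 hws).mul_left _)
    rw [hg0 _ h1, zero_mul, sub_zero] at this
    refine this.trans (le_of_eq ?_)
    rw [← tsum_mul_left]
    congr 1 with r
    ring
  rw [e1, e2, ← Finset.sum_sub_distrib]
  calc |∑ t ∈ I ×ˢ I, (c t.1 * d t.2 * θ t.1 t.2 *
        ∫ x, g t.1 x * g t.2 x ∂(Measure.infinitePi ν) -
        c t.1 * d t.2 * ∫ x, g t.1 x * g t.2 x ∂(Measure.infinitePi ν))|
      ≤ ∑ t ∈ I ×ˢ I, |c t.1| * |d t.2| *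
          (A ^ 2 * (η * ∑' r, v (r - t.1) * v (r - t.2))) := by
        refine (Finset.abs_sum_le_sum_abs _ _).trans (Finset.sum_le_sum fun t ht => ?_)
        rw [show c t.1 * d t.2 * θ t.1 t.2 *
          ∫ x, g t.1 x * g t.2 x ∂(Measure.infinitePi ν) -
          c t.1 * d t.2 * ∫ x, g t.1 x * g t.2 x ∂(Measure.infinitePi ν) =
          c t.1 * d t.2 * ((θ t.1 t.2 - 1) * ∫ x, g t.1 x * g t.2 x ∂(Measure.infinitePi ν)) by
            ring, abs_mul, abs_mul, abs_mul]
        refine mul_le_mul_of_nonneg_left ?_ (by positivity)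
        calc |θ t.1 t.2 - 1| * |∫ x, g t.1 x * g t.2 x ∂(Measure.infinitePi ν)|
            ≤ |θ t.1 t.2 - 1| * (A ^ 2 * ∑' r, w (r - t.1) * w (r - t.2)) := by
              gcongr; exact hcov t ht
          _ = A ^ 2 * ∑' r, |θ t.1 t.2 - 1| * (w (r - t.1) * w (r - t.2)) := by
              rw [tsum_mul_left]; ring
          _ ≤ A ^ 2 * ∑' r, η * (v (r - t.1) * v (r - t.2)) := by
              refine mul_le_mul_of_nonneg_left ?_ (sq_nonneg A)
              exact ((hww _ _).mul_left _).tsum_le_tsum (fun r => hθ _ _ r)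
                ((hvv _ _).mul_left _)
          _ = _ := by rw [tsum_mul_left]
    _ = A ^ 2 * η * ∑' r, absConv I c v r * absConv I d v r := by
        have h1 : ∀ r, absConv I c v r * absConv I d v r =
            ∑ t ∈ I ×ˢ I, |c t.1| * |d t.2| * (v (r - t.1) * v (r - t.2)) := by
          intro r
          rw [absConv, absConv, Finset.sum_mul_sum, ← Finset.sum_product']
          exact Finset.sum_congr rfl fun t _ => by ring
        simp_rw [h1]
        rw [Summable.tsum_finsetSum fun t _ => (hvv _ _).mul_left _, Finset.mul_sum]
        refine Finset.sum_congr rfl fun t _ => ?_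
        rw [tsum_mul_left]; ring
    _ ≤ _ := by
        gcongr
        exact tsum_absConv_mul_le hv hvs I hc hd

end Quadratic

/-! ### Kernels and lattice weights -/

section Lattice

lemma summable_int_one_add_abs_rpow {s : ℝ} (hs : 1 < s) :
    Summable fun h : ℤ => (1 + |(h : ℝ)|) ^ (-s) := by
  have hn : Summable fun n : ℕ => (1 + (n : ℝ)) ^ (-s) := by
    have := (summable_nat_add_iff 1).2 (Real.summable_nat_rpow.2 (show -s < -1 by linarith))
    refine this.congr fun n => ?_
    push_cast
    rw [add_comm]
  refine Summable.of_nat_of_neg ?_ ?_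
  · simpa using hn
  · simpa using hn

/-- The polynomial weight `1 + |h₁| + |h₂|` of a lag. -/
noncomputable def lagWeight (h : ℤ × ℤ) : ℝ := 1 + |(h.1 : ℝ)| + |(h.2 : ℝ)|

lemma one_le_lagWeight (h : ℤ × ℤ) : 1 ≤ lagWeight h := by
  unfold lagWeight
  linarith [abs_nonneg (h.1 : ℝ), abs_nonneg (h.2 : ℝ)]

lemma summable_lagWeight : Summable fun h : ℤ × ℤ => (lagWeight h ^ 4)⁻¹ := by
  have h1 := summable_int_one_add_abs_rpow (s := 2) one_lt_two
  have h2 : Summable fun h : ℤ × ℤ => (1 + |(h.1 : ℝ)|) ^ (-2 : ℝ) * (1 + |(h.2 : ℝ)|) ^ (-2 : ℝ) :=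
    h1.mul_of_nonneg h1 (fun _ => by positivity) (fun _ => by positivity)
  refine Summable.of_nonneg_of_le
    (fun h => inv_nonneg.2 (pow_nonneg (by linarith [one_le_lagWeight h]) _)) (fun h => ?_) h2
  have e : ∀ x : ℝ, 0 ≤ x → x ^ (-2 : ℝ) = (x ^ 2)⁻¹ := fun x hx => by
    rw [Real.rpow_neg hx]; norm_num
  rw [e _ (by positivity), e _ (by positivity), ← mul_inv]
  have a1 := abs_nonneg (h.1 : ℝ)
  have a2 := abs_nonneg (h.2 : ℝ)
  refine inv_anti₀ (by positivity) ?_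
  calc (1 + |(h.1 : ℝ)|) ^ 2 * (1 + |(h.2 : ℝ)|) ^ 2 ≤ lagWeight h ^ 2 * lagWeight h ^ 2 := by
        have b1 : 1 + |(h.1 : ℝ)| ≤ lagWeight h := by unfold lagWeight; linarith
        have b2 : 1 + |(h.2 : ℝ)| ≤ lagWeight h := by unfold lagWeight; linarith
        gcongr
    _ = _ := by ring

end Lattice

section Kernel

variable {K : ℝ → ℝ}

/-- A kernel with `∫ x K(x) dx < ∞` decays at least quadratically. -/
lemma IsVarianceKernel.exists_le_inv_sq (hK : IsVarianceKernel K) :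
    ∃ A : ℝ, 0 ≤ A ∧ ∀ x, K x ≤ A * ((1 + |x|) ^ 2)⁻¹ := by
  set J := ∫ x in Set.Ioi (0 : ℝ), x * K x
  have hJ : 0 ≤ J := setIntegral_nonneg measurableSet_Ioi fun x hx =>
    mul_nonneg (le_of_lt hx) (hK.mem_unit x).1
  have h1 : ∀ x : ℝ, 0 < x → x ^ 2 * K x ≤ 4 * J := by
    intro x hx
    have hsub : Set.Ioc (x / 2) x ⊆ Set.Ioi 0 := fun t ht => lt_trans (by positivity) ht.1
    have h2 : ∫ t in Set.Ioc (x / 2) x, t * K t ≤ J :=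
      setIntegral_mono_set hK.integrable_mul
        ((ae_restrict_iff' measurableSet_Ioi).2 (ae_of_all _ fun t ht =>
          mul_nonneg (le_of_lt ht) (hK.mem_unit t).1)) hsub.eventuallyLE
    have h3 : ∫ t in Set.Ioc (x / 2) x, x / 2 * K x ≤ ∫ t in Set.Ioc (x / 2) x, t * K t := by
      refine setIntegral_mono_on (integrableOn_const (by simp)) (hK.integrable_mul.mono_set hsub)
        measurableSet_Ioc fun t ht => ?_
      have ht0 : 0 < t := hsub ht
      exact mul_le_mul ht.1.le (hK.antitone (Set.mem_Ici.2 ht0.le) (Set.mem_Ici.2 hx.le) ht.2)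
        (hK.mem_unit x).1 ht0.le
    rw [setIntegral_const, measureReal_def, Real.volume_Ioc, smul_eq_mul,
      ENNReal.toReal_ofReal (by linarith)] at h3
    nlinarith
  have h4 : ∀ x : ℝ, 0 ≤ x → K x ≤ (16 * J + 4) * ((1 + x) ^ 2)⁻¹ := by
    intro x hx
    rw [← div_eq_mul_inv, le_div_iff₀ (by positivity)]
    have hK0 := (hK.mem_unit x).1
    have hK1 := (hK.mem_unit x).2
    rcases le_total x 1 with h | h
    · nlinarith
    · have := h1 x (by linarith)
      nlinarith
  refine ⟨16 * J + 4, by positivity, fun x => ?_⟩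
  rcases le_total 0 x with hx | hx
  · rw [abs_of_nonneg hx]; exact h4 x hx
  · rw [abs_of_nonpos hx, ← hK.symm]; exact h4 (-x) (by linarith)

/-- Row sums of the rescaled kernel are at most of order `b ^ (3 / 2)`. The exponent is not sharp,
but it allows a direct comparison with a summable sequence. -/
lemma IsVarianceKernel.exists_sum_le (hK : IsVarianceKernel K) :
    ∃ A : ℝ, 0 ≤ A ∧ ∀ b : ℝ, 1 ≤ b → ∀ (s : Finset ℤ) (k : ℤ),
      ∑ l ∈ s, K (((k : ℝ) - l) / b) ≤ A * b ^ (3 / 2 : ℝ) := by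
  obtain ⟨A, hA, hKA⟩ := hK.exists_le_inv_sq
  have hsum := summable_int_one_add_abs_rpow (s := 3 / 2) (by norm_num)
  have hpos : ∀ h : ℤ, 0 ≤ (1 + |(h : ℝ)|) ^ (-(3 / 2) : ℝ) := fun h => by positivity
  refine ⟨A * ∑' h : ℤ, (1 + |(h : ℝ)|) ^ (-(3 / 2) : ℝ), mul_nonneg hA (tsum_nonneg hpos),
    fun b hb s k => ?_⟩
  have hb0 : 0 < b := by linarith
  have h1 : ∀ h : ℤ, K ((h : ℝ) / b) ≤ A * b ^ (3 / 2 : ℝ) * (1 + |(h : ℝ)|) ^ (-(3 / 2) : ℝ) := by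
    intro h
    refine (hKA _).trans ?_
    rw [mul_assoc]
    refine mul_le_mul_of_nonneg_left ?_ hA
    have ha := abs_nonneg (h : ℝ)
    have h2 : (1 + |(h : ℝ)|) / b ≤ 1 + |(h : ℝ) / b| := by
      rw [abs_div, abs_of_pos hb0, add_div]
      gcongr
      exact div_le_one_of_le₀ hb hb0.le
    have h3 : (1 : ℝ) ≤ 1 + |(h : ℝ) / b| := by linarith [abs_nonneg ((h : ℝ) / b)]
    calc ((1 + |(h : ℝ) / b|) ^ 2)⁻¹ ≤ ((1 + |(h : ℝ) / b|) ^ (3 / 2 : ℝ))⁻¹ := by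
          refine inv_anti₀ (by positivity) ?_
          rw [← Real.rpow_natCast]
          exact Real.rpow_le_rpow_of_exponent_le h3 (by norm_num)
      _ ≤ (((1 + |(h : ℝ)|) / b) ^ (3 / 2 : ℝ))⁻¹ := by
          refine inv_anti₀ (by positivity) ?_
          gcongr
      _ = _ := by
          rw [Real.div_rpow (by positivity) hb0.le, Real.rpow_neg (by positivity), inv_div,
            div_eq_mul_inv]
  calc ∑ l ∈ s, K (((k : ℝ) - l) / b)
      ≤ ∑ l ∈ s, A * b ^ (3 / 2 : ℝ) * (1 + |((k - l : ℤ) : ℝ)|) ^ (-(3 / 2) : ℝ) := by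
        refine Finset.sum_le_sum fun l _ => ?_
        have := h1 (k - l)
        push_cast at this ⊢
        exact this
    _ ≤ A * b ^ (3 / 2 : ℝ) * ∑' h : ℤ, (1 + |(h : ℝ)|) ^ (-(3 / 2) : ℝ) := by
        rw [← Finset.mul_sum]
        refine mul_le_mul_of_nonneg_left ?_ (by positivity)
        exact sum_sub_left_le_tsum hpos hsum s k
    _ = _ := by ring

/-- A kernel is Lipschitz at the origin, globally because it is bounded. -/
lemma IsVarianceKernel.exists_abs_sub_one_le (hK : IsVarianceKernel K) :
    ∃ L : ℝ, 0 ≤ L ∧ ∀ x, |K x - 1| ≤ L * |x| := by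
  have hd : DifferentiableAt ℝ K 0 := hK.contDiff.differentiable one_ne_zero 0
  obtain ⟨c, hc, h⟩ := hd.isBigO_sub.exists_pos
  rw [Asymptotics.IsBigOWith, Metric.eventually_nhds_iff] at h
  obtain ⟨δ, hδ, h⟩ := h
  refine ⟨c + 1 / δ, by positivity, fun x => ?_⟩
  rw [add_mul]
  by_cases hx : |x| < δ
  · have := h (y := x) (by simpa [Real.dist_eq] using hx)
    simp only [hK.map_zero, Real.norm_eq_abs, sub_zero] at this
    have h0 : 0 ≤ 1 / δ * |x| := by positivity
    linarith
  · have h1 : |K x - 1| ≤ 1 := by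
      have := hK.mem_unit x
      rw [abs_le]; constructor <;> linarith [this.1, this.2]
    have h2 : 1 ≤ 1 / δ * |x| := by
      rw [div_mul_eq_mul_div, one_mul, le_div_iff₀ hδ]; linarith [not_lt.1 hx]
    have h0 : 0 ≤ c * |x| := by positivity
    linarith

/-- The product kernel at the lag `k - l`. -/
noncomputable def lagKernel (K : ℝ → ℝ) (b : ℝ) (k l : ℤ × ℤ) : ℝ :=
  K (((k.1 : ℝ) - l.1) / b) * K (((k.2 : ℝ) - l.2) / b)

lemma lagKernel_nonneg (hK : IsVarianceKernel K) (b : ℝ) (k l : ℤ × ℤ) :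
    0 ≤ lagKernel K b k l := mul_nonneg (hK.mem_unit _).1 (hK.mem_unit _).1

lemma lagKernel_comm (hK : IsVarianceKernel K) (b : ℝ) (k l : ℤ × ℤ) :
    lagKernel K b k l = lagKernel K b l k := by
  unfold lagKernel
  rw [← hK.symm, ← hK.symm (((k.2 : ℝ) - l.2) / b), ← neg_div, ← neg_div, neg_sub, neg_sub]

/-- Row sums of the product kernel are `O(b ^ 3)`. -/
lemma exists_sum_lagKernel_le (hK : IsVarianceKernel K) :
    ∃ A : ℝ, 0 ≤ A ∧ ∀ b : ℝ, 1 ≤ b → ∀ (s t : Finset ℤ) (k : ℤ × ℤ),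
      ∑ l ∈ s ×ˢ t, lagKernel K b k l ≤ A * b ^ 3 := by
  obtain ⟨A, hA, h⟩ := hK.exists_sum_le
  refine ⟨A * A, by positivity, fun b hb s t k => ?_⟩
  have hb0 : 0 ≤ b := by linarith
  unfold lagKernel
  rw [Finset.sum_product]
  simp only
  rw [← Finset.sum_mul_sum]
  calc _ ≤ (A * b ^ (3 / 2 : ℝ)) * (A * b ^ (3 / 2 : ℝ)) :=
        mul_le_mul (h b hb s k.1) (h b hb t k.2)
          (Finset.sum_nonneg fun _ _ => (hK.mem_unit _).1) (by positivity)
    _ = A * A * (b ^ (3 / 2 : ℝ) * b ^ (3 / 2 : ℝ)) := by ring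
    _ = A * A * b ^ 3 := by
        rw [← Real.rpow_add_of_nonneg hb0 (by norm_num) (by norm_num)]
        norm_num

/-- The deviation of the kernel from one costs one power of the lag weight and gains a factor
`1 / b`. -/
lemma exists_abs_lagKernel_sub_one_le (hK : IsVarianceKernel K) :
    ∃ L : ℝ, 0 ≤ L ∧ ∀ b : ℝ, 0 < b → ∀ k l r : ℤ × ℤ,
      |lagKernel K b k l - 1| * ((lagWeight (r - k) ^ 5)⁻¹ * (lagWeight (r - l) ^ 5)⁻¹) ≤
        L / b * ((lagWeight (r - k) ^ 4)⁻¹ * (lagWeight (r - l) ^ 4)⁻¹) := by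
  obtain ⟨L, hL, h⟩ := hK.exists_abs_sub_one_le
  refine ⟨2 * L, by positivity, fun b hb k l r => ?_⟩
  set x := lagWeight (r - k) with hx
  set y := lagWeight (r - l) with hy
  have hx1 : 1 ≤ x := one_le_lagWeight _
  have hy1 : 1 ≤ y := one_le_lagWeight _
  have h1 : |lagKernel K b k l - 1| ≤ L / b * (x + y) := by
    set u := K (((k.1 : ℝ) - l.1) / b)
    set v := K (((k.2 : ℝ) - l.2) / b)
    have hu : |u - 1| ≤ L * (|(k.1 : ℝ) - l.1| / b) := by
      have := h (((k.1 : ℝ) - l.1) / b)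
      rwa [abs_div, abs_of_pos hb] at this
    have hv : |v - 1| ≤ L * (|(k.2 : ℝ) - l.2| / b) := by
      have := h (((k.2 : ℝ) - l.2) / b)
      rwa [abs_div, abs_of_pos hb] at this
    have hv01 : |v| ≤ 1 := by
      have := hK.mem_unit (((k.2 : ℝ) - l.2) / b)
      rw [abs_le]; constructor <;> linarith [this.1, this.2]
    have h2 : |lagKernel K b k l - 1| ≤ |u - 1| + |v - 1| := by
      have e : lagKernel K b k l - 1 = (u - 1) * v + (v - 1) := by
        simp only [lagKernel, u, v]; ring
      rw [e]
      refine (abs_add_le _ _).trans (add_le_add_left ?_ _)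
      rw [abs_mul]
      exact mul_le_of_le_one_right (abs_nonneg _) hv01
    have h3 : |(k.1 : ℝ) - l.1| + |(k.2 : ℝ) - l.2| ≤ x + y := by
      have e1 : |(k.1 : ℝ) - l.1| ≤ |(r.1 : ℝ) - k.1| + |(r.1 : ℝ) - l.1| := by
        rw [abs_sub_comm (r.1 : ℝ) k.1]; exact abs_sub_le _ _ _
      have e2 : |(k.2 : ℝ) - l.2| ≤ |(r.2 : ℝ) - k.2| + |(r.2 : ℝ) - l.2| := by
        rw [abs_sub_comm (r.2 : ℝ) k.2]; exact abs_sub_le _ _ _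
      simp only [hx, hy, lagWeight, Prod.fst_sub, Prod.snd_sub, Int.cast_sub]
      linarith
    calc |lagKernel K b k l - 1| ≤ L / b * (|(k.1 : ℝ) - l.1| + |(k.2 : ℝ) - l.2|) := by
          refine h2.trans ((add_le_add hu hv).trans (le_of_eq ?_))
          ring
      _ ≤ _ := by gcongr
  have hx0 : 0 < x := by linarith
  have hy0 : 0 < y := by linarith
  calc |lagKernel K b k l - 1| * ((x ^ 5)⁻¹ * (y ^ 5)⁻¹)
      ≤ L / b * (x + y) * ((x ^ 5)⁻¹ * (y ^ 5)⁻¹) := by gcongr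
    _ ≤ L / b * (2 * (x * y)) * ((x ^ 5)⁻¹ * (y ^ 5)⁻¹) := by
        gcongr
        nlinarith
    _ = _ := by field_simp

end Kernel

/-! ### Maxima of finitely many variables -/

/-- The crude union bound for the `Lᵖ` norm of a maximum. -/
lemma eLpNorm_iSup_abs_le {Ω : Type*} [MeasurableSpace Ω] {P : Measure Ω} {ι : Type*} [Fintype ι]
    [Nonempty ι] {p : ℝ} (hp : 0 < p) {Z : ι → Ω → ℝ} (hZ : ∀ v, Measurable (Z v)) {R : ℝ}
    (hR : ∀ v, eLpNorm (Z v) (ENNReal.ofReal p) P ≤ ENNReal.ofReal R) :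
    eLpNorm (fun ω => ⨆ v, |Z v ω|) (ENNReal.ofReal p) P ≤
      ENNReal.ofReal ((Fintype.card ι : ℝ) ^ (1 / p) * R) := by
  have hp0 : ENNReal.ofReal p ≠ 0 := by simpa using hp
  have hpow : ∀ v, ∫⁻ ω, ‖Z v ω‖ₑ ^ p ∂P ≤ ENNReal.ofReal R ^ p := by
    intro v
    have h := hR v
    rw [eLpNorm_eq_lintegral_rpow_enorm_toReal hp0 ENNReal.ofReal_ne_top,
      ENNReal.toReal_ofReal hp.le] at h
    calc ∫⁻ ω, ‖Z v ω‖ₑ ^ p ∂P = ((∫⁻ ω, ‖Z v ω‖ₑ ^ p ∂P) ^ (1 / p)) ^ p := by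
          rw [← ENNReal.rpow_mul, one_div, inv_mul_cancel₀ hp.ne', ENNReal.rpow_one]
      _ ≤ _ := by gcongr
  have hsup : ∀ ω, ‖⨆ v, |Z v ω|‖ₑ ^ p ≤ ∑ v, ‖Z v ω‖ₑ ^ p := by
    intro ω
    obtain ⟨v, hv⟩ := exists_eq_ciSup_of_finite (f := fun v => |Z v ω|)
    rw [← hv]
    calc ‖|Z v ω|‖ₑ ^ p = ‖Z v ω‖ₑ ^ p := by rw [← Real.norm_eq_abs, enorm_norm]
      _ ≤ _ := Finset.single_le_sum (f := fun v => ‖Z v ω‖ₑ ^ p) (fun _ _ => zero_le)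
        (Finset.mem_univ v)
  rw [eLpNorm_eq_lintegral_rpow_enorm_toReal hp0 ENNReal.ofReal_ne_top,
    ENNReal.toReal_ofReal hp.le]
  calc (∫⁻ ω, ‖⨆ v, |Z v ω|‖ₑ ^ p ∂P) ^ (1 / p)
      ≤ (∫⁻ ω, ∑ v, ‖Z v ω‖ₑ ^ p ∂P) ^ (1 / p) := by
        gcongr with ω
        exact hsup ω
    _ = (∑ v, ∫⁻ ω, ‖Z v ω‖ₑ ^ p ∂P) ^ (1 / p) := by
        rw [lintegral_finsetSum _ fun v _ => (hZ v).enorm.pow_const p]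
    _ ≤ (∑ _v : ι, ENNReal.ofReal R ^ p) ^ (1 / p) := by
        gcongr with v
        exact hpow v
    _ = _ := by
        rw [Finset.sum_const, Finset.card_univ, nsmul_eq_mul,
          ENNReal.mul_rpow_of_nonneg _ _ (by positivity), ← ENNReal.rpow_mul,
          mul_one_div_cancel hp.ne', ENNReal.rpow_one, ENNReal.ofReal_mul (by positivity),
          ← ENNReal.ofReal_rpow_of_nonneg (by positivity) (by positivity), ENNReal.ofReal_natCast]

/-! ### Random fields as functionals of their innovations -/

section Field

variable {Ω : Type*} [MeasurableSpace Ω]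

/-- The value of the field at the site `k`, as a functional of the whole family of innovations. -/
def siteFun (G : ℤ → ℤ → (ℤ × ℤ → ℝ) → ℝ) (k : ℤ × ℤ) (x : ℤ × ℤ → ℝ) : ℝ :=
  G k.1 k.2 fun u => x (k.1 - u.1, k.2 - u.2)

lemma measurable_siteFun {G : ℤ → ℤ → (ℤ × ℤ → ℝ) → ℝ} {k : ℤ × ℤ} (hG : Measurable (G k.1 k.2)) :
    Measurable (siteFun G k) :=
  hG.comp (measurable_pi_iff.2 fun _ => measurable_pi_apply _)

variable {P : Measure Ω} {e : ℤ × ℤ → Ω → ℝ}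

lemma measurePreserving_innovations (he : ∀ k, Measurable (e k)) (hind : iIndepFun e P) :
    MeasurePreserving (fun ω k => e k ω) P (Measure.infinitePi fun k => P.map (e k)) :=
  ⟨measurable_pi_iff.2 he, hind.map_fun_eq_infinitePi_map he⟩

variable [IsProbabilityMeasure P]

/-- The dependence measures are the influences of the innovations. -/
lemma siteDependence_eq_influence (he : ∀ k, Measurable (e k)) (hind : iIndepFun e P) (M : ℝ)
    {G : ℤ → ℤ → (ℤ × ℤ → ℝ) → ℝ} {i j : ℤ} (hG : Measurable (G i j)) (p q : ℤ) :
    siteDependence P M e (G i j) i j p q =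
      influence (fun k => P.map (e k)) M (siteFun G (i, j)) (i + p, j + q) := by
  have hΦ := measurePreserving_innovations he hind
  have hprob : ∀ k, IsProbabilityMeasure (P.map (e k)) := fun k =>
    Measure.isProbabilityMeasure_map (he k).aemeasurable
  have hg : Measurable (siteFun G (i, j)) := measurable_siteFun hG
  have hH : Measurable fun z : (ℤ × ℤ → ℝ) × (ℤ × ℤ → ℝ) => siteFun G (i, j) z.1 -
      siteFun G (i, j) (Function.update z.1 (i + p, j + q) (z.2 (i + p, j + q))) :=
    (hg.comp measurable_fst).sub (hg.comp (measurable_update_copy _))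
  rw [influence_eq, ← eLpNorm_comp_measurePreserving hH.aestronglyMeasurable (hΦ.prod hΦ)]
  unfold siteDependence
  congr 1
  funext z
  simp only [Function.comp, Prod.map, siteFun]
  congr 2
  funext u
  simp only [shiftedReplaced, Function.update_apply, Prod.mk.injEq]
  split_ifs with h
  · rw [h.1, h.2]
  · rfl

/-- Finite sample bounds for the stochastic part and for the bias of the estimator. -/
lemma hacEstimator_bounds (he : ∀ k, Measurable (e k)) (hind : iIndepFun e P) {M : ℝ} (hM : 4 ≤ M)
    {n m : ℕ} {G : ℤ → ℤ → (ℤ × ℤ → ℝ) → ℝ} {X : ℤ → ℤ → Ω → ℝ}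
    (hG : ∀ i ∈ Finset.Icc (1 : ℤ) n, ∀ j ∈ Finset.Icc (1 : ℤ) m, Measurable (G i j))
    (hX : ∀ i ∈ Finset.Icc (1 : ℤ) n, ∀ j ∈ Finset.Icc (1 : ℤ) m,
      ∀ ω, X i j ω = G i j (shifted e i j ω))
    (hX0 : ∀ i ∈ Finset.Icc (1 : ℤ) n, ∀ j ∈ Finset.Icc (1 : ℤ) m, ∫ ω, X i j ω ∂P = 0)
    {A : ℝ} (hA : 0 ≤ A)
    (hXA : ∀ i ∈ Finset.Icc (1 : ℤ) n, ∀ j ∈ Finset.Icc (1 : ℤ) m,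
      eLpNorm (X i j) (ENNReal.ofReal M) P ≤ ENNReal.ofReal A)
    (hdep : ∀ i ∈ Finset.Icc (1 : ℤ) n, ∀ j ∈ Finset.Icc (1 : ℤ) m, ∀ p q : ℤ,
      siteDependence P M e (G i j) i j p q ≤ ENNReal.ofReal (A * (lagWeight (p, q) ^ 5)⁻¹))
    {K : ℝ → ℝ} (hK : IsVarianceKernel K) {B AK L : ℝ} (hB : 1 ≤ B) (hAK : 0 ≤ AK) (hL : 0 ≤ L)
    (hKsum : ∀ (s t : Finset ℤ) (k : ℤ × ℤ), ∑ l ∈ s ×ˢ t, lagKernel K B k l ≤ AK * B ^ 3)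
    (hKL : ∀ k l r : ℤ × ℤ,
      |lagKernel K B k l - 1| * ((lagWeight (r - k) ^ 5)⁻¹ * (lagWeight (r - l) ^ 5)⁻¹) ≤
        L / B * ((lagWeight (r - k) ^ 4)⁻¹ * (lagWeight (r - l) ^ 4)⁻¹))
    {c d : ℤ → ℤ → ℝ} {b : ℝ} (hb : 0 ≤ b)
    (hc : ∑ i ∈ Finset.Icc (1 : ℤ) n, ∑ j ∈ Finset.Icc (1 : ℤ) m, c i j ^ 2 ≤ 1)
    (hd : ∑ i ∈ Finset.Icc (1 : ℤ) n, ∑ j ∈ Finset.Icc (1 : ℤ) m, d i j ^ 2 ≤ 1)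
    (hcb : ∀ i ∈ Finset.Icc (1 : ℤ) n, ∀ j ∈ Finset.Icc (1 : ℤ) m, |c i j| ≤ b)
    (hdb : ∀ i ∈ Finset.Icc (1 : ℤ) n, ∀ j ∈ Finset.Icc (1 : ℤ) m, |d i j| ≤ b) :
    Measurable (hacEstimator K B n m c d X) ∧
    eLpNorm (fun ω => hacEstimator K B n m c d X ω - ∫ ω', hacEstimator K B n m c d X ω' ∂P)
      (ENNReal.ofReal (M / 2)) P ≤ ENNReal.ofReal (√(smoothConst (M / 2)) *
        (2 * A ^ 2 * (b * (AK * B ^ 3)) * ∑' h, (lagWeight h ^ 4)⁻¹)) ∧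
    |(∫ ω, hacEstimator K B n m c d X ω ∂P) -
      covariance (linearForm n m c X) (linearForm n m d X) P| ≤
      A ^ 2 * (L / B) * (∑' h, (lagWeight h ^ 4)⁻¹) ^ 2 := by
  have hprob : ∀ k, IsProbabilityMeasure (P.map (e k)) := fun k =>
    Measure.isProbabilityMeasure_map (he k).aemeasurable
  have hΦ := measurePreserving_innovations he hind
  set Φ : Ω → ℤ × ℤ → ℝ := fun ω k => e k ω with hΦdef
  set μ := Measure.infinitePi fun k => P.map (e k) with hμ
  set I : Finset (ℤ × ℤ) := Finset.Icc (1 : ℤ) n ×ˢ Finset.Icc (1 : ℤ) m with hI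
  have hgm : ∀ k ∈ I, Measurable (siteFun G k) := fun k hk =>
    measurable_siteFun (hG _ (Finset.mem_product.1 hk).1 _ (Finset.mem_product.1 hk).2)
  have hXg : ∀ k ∈ I, X k.1 k.2 = fun ω => siteFun G k (Φ ω) := fun k hk => by
    funext ω
    exact hX _ (Finset.mem_product.1 hk).1 _ (Finset.mem_product.1 hk).2 ω
  have hgA : ∀ k ∈ I, eLpNorm (siteFun G k) (ENNReal.ofReal M) μ ≤ ENNReal.ofReal A := by
    intro k hk
    have h := hXA _ (Finset.mem_product.1 hk).1 _ (Finset.mem_product.1 hk).2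
    rw [hXg k hk] at h
    rwa [← eLpNorm_comp_measurePreserving (hgm k hk).aestronglyMeasurable hΦ]
  have htr : ∀ {f : (ℤ × ℤ → ℝ) → ℝ}, Measurable f → ∫ ω, f (Φ ω) ∂P = ∫ x, f x ∂μ := by
    intro f hf
    rw [← hΦ.map_eq, integral_map hΦ.measurable.aemeasurable hf.aestronglyMeasurable]
  have hg0 : ∀ k ∈ I, ∫ x, siteFun G k x ∂μ = 0 := by
    intro k hk
    have h := hX0 _ (Finset.mem_product.1 hk).1 _ (Finset.mem_product.1 hk).2
    rw [hXg k hk] at h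
    rwa [← htr (hgm k hk)]
  have hgw : ∀ k ∈ I, ∀ r, influence (fun k => P.map (e k)) M (siteFun G k) r ≤
      ENNReal.ofReal (A * (lagWeight (r - k) ^ 5)⁻¹) := by
    intro k hk r
    have hk1 := (Finset.mem_product.1 hk).1
    have hk2 := (Finset.mem_product.1 hk).2
    have h := hdep _ hk1 _ hk2 (r.1 - k.1) (r.2 - k.2)
    rw [siteDependence_eq_influence he hind M (hG _ hk1 _ hk2)] at h
    simp only [add_sub_cancel] at h
    exact h
  have hpos : ∀ h : ℤ × ℤ, 0 < lagWeight h := fun h => by linarith [one_le_lagWeight h]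
  have hw5 : ∀ h : ℤ × ℤ, 0 ≤ (lagWeight h ^ 5)⁻¹ := fun h =>
    inv_nonneg.2 (pow_nonneg (hpos h).le _)
  have hw4 : ∀ h : ℤ × ℤ, 0 ≤ (lagWeight h ^ 4)⁻¹ := fun h =>
    inv_nonneg.2 (pow_nonneg (hpos h).le _)
  -- the fifth power bounds the influences, the fourth one is what the bias leaves of it
  have hw54 : ∀ h : ℤ × ℤ, (lagWeight h ^ 5)⁻¹ ≤ (lagWeight h ^ 4)⁻¹ := fun h =>
    inv_anti₀ (pow_pos (hpos h) _) (pow_le_pow_right₀ (one_le_lagWeight h) (by norm_num))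
  have hs5 : Summable fun h : ℤ × ℤ => ((lagWeight h ^ 5)⁻¹) ^ 2 := by
    refine Summable.of_nonneg_of_le (fun _ => sq_nonneg _) (fun h => ?_) summable_lagWeight
    refine le_trans ?_ (hw54 h)
    have : (lagWeight h ^ 5)⁻¹ ≤ 1 := inv_le_one_of_one_le₀ (one_le_pow₀ (one_le_lagWeight h))
    nlinarith [hw5 h]
  set c' : ℤ × ℤ → ℝ := fun k => c k.1 k.2 with hc'
  set d' : ℤ × ℤ → ℝ := fun k => d k.1 k.2 with hd'
  have hc1 : ∑ k ∈ I, c' k ^ 2 ≤ 1 := by rwa [hI, Finset.sum_product]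
  have hd1 : ∑ k ∈ I, d' k ^ 2 ≤ 1 := by rwa [hI, Finset.sum_product]
  have hcb1 : ∀ k ∈ I, |c' k| ≤ b := fun k hk =>
    hcb _ (Finset.mem_product.1 hk).1 _ (Finset.mem_product.1 hk).2
  have hdb1 : ∀ k ∈ I, |d' k| ≤ b := fun k hk =>
    hdb _ (Finset.mem_product.1 hk).1 _ (Finset.mem_product.1 hk).2
  set Q : (ℤ × ℤ → ℝ) → ℝ := fun x => ∑ t ∈ I ×ˢ I,
    c' t.1 * d' t.2 * lagKernel K B t.1 t.2 * (siteFun G t.1 x * siteFun G t.2 x) with hQ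
  have hQm : Measurable Q := Finset.measurable_fun_sum _ fun t ht =>
    ((hgm _ (Finset.mem_product.1 ht).1).mul (hgm _ (Finset.mem_product.1 ht).2)).const_mul _
  have hhac : hacEstimator K B n m c d X = fun ω => Q (Φ ω) := by
    funext ω
    simp only [hQ, Finset.sum_product I I]
    rw [hI, Finset.sum_product]
    unfold hacEstimator
    refine Finset.sum_congr rfl fun i₁ h1 => Finset.sum_congr rfl fun j₁ h2 => ?_
    rw [Finset.sum_product]
    refine Finset.sum_congr rfl fun i₂ h3 => Finset.sum_congr rfl fun j₂ h4 => ?_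
    have e1 := hXg (i₁, j₁) (Finset.mem_product.2 ⟨h1, h2⟩)
    have e2 := hXg (i₂, j₂) (Finset.mem_product.2 ⟨h3, h4⟩)
    simp only at e1 e2
    rw [e1, e2]
    simp only [lagKernel, hc', hd']
    ring
  have hlin : ∀ a : ℤ → ℤ → ℝ, linearForm n m a X =
      fun ω => ∑ k ∈ I, a k.1 k.2 * siteFun G k (Φ ω) := by
    intro a
    funext ω
    unfold linearForm
    rw [← Finset.sum_product' (f := fun i j => a i j * X i j ω)]
    exact Finset.sum_congr rfl fun k hk => by rw [hXg k hk]
  have hlinm : ∀ a : ℤ → ℤ → ℝ, Measurable fun x => ∑ k ∈ I, a k.1 k.2 * siteFun G k x :=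
    fun a => Finset.measurable_fun_sum _ fun k hk => (hgm k hk).const_mul _
  have hlin0 : ∀ a : ℤ → ℤ → ℝ, ∫ ω, linearForm n m a X ω ∂P = 0 := by
    intro a
    rw [hlin, htr (hlinm a), integral_finsetSum]
    · refine Finset.sum_eq_zero fun k hk => ?_
      rw [integral_const_mul, hg0 k hk, mul_zero]
    · intro k hk
      refine Integrable.const_mul (MemLp.integrable (one_le_ofReal (p := M) (by linarith))
        ⟨(hgm k hk).aestronglyMeasurable, (hgA k hk).trans_lt ENNReal.ofReal_lt_top⟩) _
  have hEQ : ∫ ω, hacEstimator K B n m c d X ω ∂P = ∫ x, Q x ∂μ := by rw [hhac, htr hQm]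
  have hK1 : ∀ k ∈ I, ∑ l ∈ I, lagKernel K B k l ≤ AK * B ^ 3 := fun k _ => hKsum _ _ k
  have hK2 : ∀ l ∈ I, ∑ k ∈ I, lagKernel K B k l ≤ AK * B ^ 3 := fun l _ => by
    simp_rw [fun k => lagKernel_comm hK B k l]
    exact hKsum _ _ l
  refine ⟨?_, ?_, ?_⟩
  · rw [hhac]; exact hQm.comp hΦ.measurable
  · have hgw4 : ∀ k ∈ I, ∀ r, influence (fun k => P.map (e k)) M (siteFun G k) r ≤
        ENNReal.ofReal (A * (lagWeight (r - k) ^ 4)⁻¹) := fun k hk r =>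
      (hgw k hk r).trans (ENNReal.ofReal_le_ofReal (mul_le_mul_of_nonneg_left (hw54 _) hA))
    have h := eLpNorm_quadratic_sub_integral_le hM hgm hA hgA hw4 summable_lagWeight hgw4
      hc1 hd1 hb (by positivity) hcb1 hdb1 (lagKernel_nonneg hK B) hK1 hK2
    rw [hEQ, hhac]
    refine le_trans (le_of_eq ?_) h
    exact eLpNorm_comp_measurePreserving (g := fun x => Q x - ∫ y, Q y ∂μ)
      (hQm.sub_const _).aestronglyMeasurable hΦ
  · have h := abs_integral_quadratic_sub_le hM hgm hA hgA hg0 hw5 hw4 hs5 summable_lagWeight hgw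
      hc1 hd1 (div_nonneg hL (by linarith)) hKL
    have hcov : covariance (linearForm n m c X) (linearForm n m d X) P =
        ∫ x, (∑ k ∈ I, c' k * siteFun G k x) * ∑ l ∈ I, d' l * siteFun G l x ∂μ := by
      rw [covariance, hlin0, hlin0]
      simp only [sub_zero]
      rw [hlin c, hlin d]
      exact htr ((hlinm c).mul (hlinm d))
    rw [hEQ, hcov]
    exact h

end Field

/-! ### Rates -/

lemma one_div_le_biasRate {α b : ℝ} (hb : Real.exp 1 ≤ b) : 1 / b ≤ biasRate α b := by
  have hb1 : 1 ≤ b := le_trans (Real.one_le_exp zero_le_one) hb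
  have hb0 : 0 < b := by linarith
  unfold biasRate
  split_ifs with h1 h2
  · rw [one_div, ← Real.rpow_neg_one]
    exact Real.rpow_le_rpow_of_exponent_le hb1 (by linarith)
  · gcongr
    rwa [Real.le_log_iff_exp_le hb0]
  · exact le_rfl

lemma sum_normalized_sq_le {n m : ℕ} {a : ℤ → ℤ → ℝ}
    (ha : 0 < ∑ i ∈ Finset.Icc (1 : ℤ) n, ∑ j ∈ Finset.Icc (1 : ℤ) m, a i j ^ 2) :
    ∑ i ∈ Finset.Icc (1 : ℤ) n, ∑ j ∈ Finset.Icc (1 : ℤ) m, normalized n m a i j ^ 2 ≤ 1 := by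
  simp only [normalized, div_pow, ← Finset.sum_div, l2norm, Real.sq_sqrt ha.le]
  rw [div_self ha.ne']

lemma abs_normalized_le {C : ℝ} (hC : 0 < C) {n m κ : ℕ} {a : ℤ → ℤ → ℝ}
    (ha : IsAdmissibleCoefficient C n m κ a) {i j : ℤ} (hi : i ∈ Finset.Icc (1 : ℤ) n)
    (hj : j ∈ Finset.Icc (1 : ℤ) m) : |normalized n m a i j| ≤ C ^ 2 / κ := by
  obtain ⟨-, -, lam, tau, hl, ht, -, -, h⟩ := ha
  have hn : |l2norm n m a| = l2norm n m a := abs_of_nonneg (Real.sqrt_nonneg _)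
  rw [normalized, abs_div, hn]
  refine (h i hi j hj).trans ?_
  calc lam i * tau j ≤ C / √(κ : ℝ) * (C / √(κ : ℝ)) :=
        mul_le_mul (hl i hi).2 (ht j hj).2 (ht j hj).1 (by positivity)
    _ = C ^ 2 / κ := by
        rw [div_mul_div_comm, Real.mul_self_sqrt (Nat.cast_nonneg κ), sq]

/-- The polynomial decay of the dependence measures at a single site. -/
lemma siteDependence_le {Ω : Type*} [MeasurableSpace Ω] {P : Measure Ω} {M α : ℝ} (hα : 5 ≤ α)
    {e : ℤ × ℤ → Ω → ℝ} {G : ℤ → ℤ → (ℤ × ℤ → ℝ) → ℝ} {n m : ℕ} {A : ℝ}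
    (h : ⨆ p : ℤ, ⨆ q : ℤ, ENNReal.ofReal ((1 + |(p : ℝ)| + |(q : ℝ)|) ^ α) *
      dependence P M e G n m p q ≤ ENNReal.ofReal A) {i j : ℤ}
    (hi : i ∈ Finset.Icc (1 : ℤ) n) (hj : j ∈ Finset.Icc (1 : ℤ) m) (p q : ℤ) :
    siteDependence P M e (G i j) i j p q ≤ ENNReal.ofReal (A * (lagWeight (p, q) ^ 5)⁻¹) := by
  set x := lagWeight (p, q) with hx
  have hx1 : 1 ≤ x := one_le_lagWeight _
  have hx0 : 0 < x ^ 5 := by positivity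
  have h1 : siteDependence P M e (G i j) i j p q ≤ dependence P M e G n m p q :=
    (le_iSup₂_of_le (f := fun j _ => siteDependence P M e (G i j) i j p q) j hj le_rfl).trans
      (le_iSup₂_of_le (f := fun i _ => ⨆ j ∈ Finset.Icc (1 : ℤ) m,
        siteDependence P M e (G i j) i j p q) i hi le_rfl)
  have h2 : ENNReal.ofReal (x ^ α) * dependence P M e G n m p q ≤ ENNReal.ofReal A :=
    (le_iSup₂ (f := fun p q : ℤ => ENNReal.ofReal ((1 + |(p : ℝ)| + |(q : ℝ)|) ^ α) *
      dependence P M e G n m p q) p q).trans h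
  have h3 : x ^ 5 ≤ x ^ α := by
    rw [← Real.rpow_natCast]
    exact Real.rpow_le_rpow_of_exponent_le hx1 (by exact_mod_cast hα)
  have h4 : siteDependence P M e (G i j) i j p q * ENNReal.ofReal (x ^ 5) ≤ ENNReal.ofReal A := by
    rw [mul_comm]
    exact (mul_le_mul' (ENNReal.ofReal_le_ofReal h3) h1).trans h2
  rw [← div_eq_mul_inv, ENNReal.ofReal_div_of_pos hx0]
  exact (ENNReal.le_div_iff_mul_le (Or.inl (by simpa using hx0))
    (Or.inl ENNReal.ofReal_ne_top)).2 h4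

end HAC

theorem mainTheorem2 {Ω : Type*} [MeasurableSpace Ω] (P : Measure Ω) [IsProbabilityMeasure P]
    (M α : ℝ) (hM : 4 < M) (hα : 5 < α)
    (ε : ℕ → ℕ → ℤ → ℤ → Ω → ℝ) (hε : HAC.IsShortRangeDependent P M α ε)
    (κ : ℕ → ℕ → ℕ)
    (hκ : Tendsto (fun s : ℕ × ℕ => κ s.1 s.2) atTop atTop)
    (hκn : Tendsto (fun s : ℕ × ℕ => (κ s.1 s.2 : ℝ) / (s.1 : ℝ)) atTop (nhds 0))
    (hκm : Tendsto (fun s : ℕ × ℕ => (κ s.1 s.2 : ℝ) / (s.2 : ℝ)) atTop (nhds 0))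
    (V : ℕ → ℕ → ℕ) (hV : ∀ n m, 1 ≤ V n m)
    (a : (n m : ℕ) → Fin (V n m) → ℤ → ℤ → ℝ)
    (C : ℝ) (hC : 0 < C)
    (ha : ∀ᶠ s : ℕ × ℕ in atTop, ∀ v : Fin (V s.1 s.2),
      HAC.IsAdmissibleCoefficient C s.1 s.2 (κ s.1 s.2) (a s.1 s.2 v))
    (K : ℝ → ℝ) (hK : HAC.IsVarianceKernel K)
    (B : ℕ → ℕ → ℝ)
    (hB : Tendsto (fun s : ℕ × ℕ => B s.1 s.2) atTop atTop)
    (hBκ : Tendsto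
      (fun s : ℕ × ℕ => (V s.1 s.2 : ℝ) ^ (4 / M) * B s.1 s.2 ^ 3 / (κ s.1 s.2 : ℝ))
      atTop (nhds 0)) :
    ∃ C' : ℝ, ∀ᶠ s : ℕ × ℕ in atTop,
      eLpNorm
        (fun ω => ⨆ v : Fin (V s.1 s.2) × Fin (V s.1 s.2),
          |HAC.hacEstimator K (B s.1 s.2) s.1 s.2
              (HAC.normalized s.1 s.2 (a s.1 s.2 v.1))
              (HAC.normalized s.1 s.2 (a s.1 s.2 v.2)) (ε s.1 s.2) ω -
            covariance
              (HAC.linearForm s.1 s.2 (HAC.normalized s.1 s.2 (a s.1 s.2 v.1)) (ε s.1 s.2))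
              (HAC.linearForm s.1 s.2 (HAC.normalized s.1 s.2 (a s.1 s.2 v.2)) (ε s.1 s.2)) P|)
        (ENNReal.ofReal (M / 2)) P ≤
      ENNReal.ofReal (C' * (HAC.biasRate α (B s.1 s.2) +
        (V s.1 s.2 : ℝ) ^ (4 / M) * B s.1 s.2 ^ 3 / (κ s.1 s.2 : ℝ))) := by
  obtain ⟨e, G, hε⟩ := hε
  obtain ⟨C₁, hC₁⟩ := hε.moment_bound
  obtain ⟨C₂, hC₂⟩ := hε.dependence_bound
  obtain ⟨AK, hAK, hKsum⟩ := HAC.exists_sum_lagKernel_le hK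
  obtain ⟨L, hL, hKL⟩ := HAC.exists_abs_lagKernel_sub_one_le hK
  set A : ℝ := max C₁ C₂ with hAdef
  have hA : 0 ≤ A := le_max_of_le_left C₁.2
  have hA₁ : (C₁ : ℝ≥0∞) ≤ ENNReal.ofReal A := by
    rw [← ENNReal.ofReal_coe_nnreal]; exact ENNReal.ofReal_le_ofReal (le_max_left _ _)
  have hA₂ : (C₂ : ℝ≥0∞) ≤ ENNReal.ofReal A := by
    rw [← ENNReal.ofReal_coe_nnreal]; exact ENNReal.ofReal_le_ofReal (le_max_right _ _)
  set W : ℝ := ∑' h, (HAC.lagWeight h ^ 4)⁻¹ with hWdef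
  have hW : 0 ≤ W := tsum_nonneg fun h =>
    inv_nonneg.2 (pow_nonneg (by linarith [HAC.one_le_lagWeight h]) _)
  set D₁ : ℝ := √(HAC.smoothConst (M / 2)) * (2 * A ^ 2 * (C ^ 2 * AK) * W)
  set D₂ : ℝ := A ^ 2 * L * W ^ 2
  have hD₁ : 0 ≤ D₁ := by positivity
  have hD₂ : 0 ≤ D₂ := by positivity
  refine ⟨D₁ + D₂, ?_⟩
  -- `exp 1 ≤ ℬ` makes `log ℬ ≥ 1`, which the rate needs for `α = 6`
  filter_upwards [ha, hC₁, hC₂, hκ.eventually_ge_atTop 1, hB.eventually_ge_atTop (Real.exp 1)]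
    with ⟨n, m⟩ ha hC₁ hC₂ hκ1 hBe
  simp only at ha hC₁ hC₂ hκ1 hBe ⊢
  have hB1 : 1 ≤ B n m := le_trans (Real.one_le_exp zero_le_one) hBe
  have hB0 : 0 < B n m := by linarith
  have hκ0 : (0 : ℝ) < κ n m := by exact_mod_cast hκ1
  have hb : 0 ≤ C ^ 2 / (κ n m : ℝ) := by positivity
  set H : Fin (V n m) × Fin (V n m) → Ω → ℝ := fun v =>
    HAC.hacEstimator K (B n m) n m (HAC.normalized n m (a n m v.1))
      (HAC.normalized n m (a n m v.2)) (ε n m) with hH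
  set Γ : Fin (V n m) × Fin (V n m) → ℝ := fun v => covariance
    (HAC.linearForm n m (HAC.normalized n m (a n m v.1)) (ε n m))
    (HAC.linearForm n m (HAC.normalized n m (a n m v.2)) (ε n m)) P with hΓ
  have hbounds := fun v : Fin (V n m) × Fin (V n m) =>
    HAC.hacEstimator_bounds hε.measurable_innovation hε.indep_innovation hM.le
      (hε.measurable_transform n m) (hε.eq_transform n m) (hε.centred n m) hA
      (fun i hi j hj => (le_iSup₂_of_le (f := fun i _ => ⨆ j ∈ Finset.Icc (1 : ℤ) m,
        eLpNorm (ε n m i j) (ENNReal.ofReal M) P) i hi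
          (le_iSup₂_of_le (f := fun j _ => eLpNorm (ε n m i j) (ENNReal.ofReal M) P) j hj
            le_rfl)).trans (hC₁.trans hA₁))
      (fun i hi j hj p q => HAC.siteDependence_le hα.le (hC₂.trans hA₂) hi hj p q)
      hK hB1 hAK hL (hKsum _ hB1) (hKL _ hB0) hb
      (HAC.sum_normalized_sq_le (ha v.1).1) (HAC.sum_normalized_sq_le (ha v.2).1)
      (fun i hi j hj => HAC.abs_normalized_le hC (ha v.1) hi hj)
      (fun i hi j hj => HAC.abs_normalized_le hC (ha v.2) hi hj)
  have hVne : Nonempty (Fin (V n m) × Fin (V n m)) :=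
    have : Nonempty (Fin (V n m)) := ⟨⟨0, hV n m⟩⟩
    inferInstance
  set R : ℝ := √(HAC.smoothConst (M / 2)) * (2 * A ^ 2 * (C ^ 2 / (κ n m : ℝ) *
    (AK * B n m ^ 3)) * W) with hRdef
  set β : ℝ := A ^ 2 * (L / B n m) * W ^ 2 with hβdef
  have hβ : 0 ≤ β := by positivity
  have hHm : ∀ v, Measurable fun ω => H v ω - ∫ ω', H v ω' ∂P := fun v =>
    (hbounds v).1.sub_const _
  have hmax := HAC.eLpNorm_iSup_abs_le (P := P) (p := M / 2) (by linarith) hHm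
    (fun v => (hbounds v).2.1)
  have hp1 : (1 : ℝ≥0∞) ≤ ENNReal.ofReal (M / 2) := HAC.one_le_ofReal (by linarith)
  have hcard : ((Fintype.card (Fin (V n m) × Fin (V n m)) : ℕ) : ℝ) ^ (1 / (M / 2)) =
      (V n m : ℝ) ^ (4 / M) := by
    rw [Fintype.card_prod, Fintype.card_fin, Nat.cast_mul, ← sq, ← Real.rpow_natCast,
      ← Real.rpow_mul (Nat.cast_nonneg _)]
    congr 1
    push_cast
    field_simp
    norm_num
  rw [hcard] at hmax
  have hpt : ∀ ω, ‖⨆ v, |H v ω - Γ v|‖ ≤ (⨆ v, |H v ω - ∫ ω', H v ω' ∂P|) + β := by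
    intro ω
    have hbdd : BddAbove (Set.range fun v => |H v ω - ∫ ω', H v ω' ∂P|) :=
      Set.finite_range _ |>.bddAbove
    rw [Real.norm_of_nonneg (Real.iSup_nonneg fun _ => abs_nonneg _)]
    refine ciSup_le fun v => ?_
    calc |H v ω - Γ v| = |(H v ω - ∫ ω', H v ω' ∂P) + ((∫ ω', H v ω' ∂P) - Γ v)| := by
          congr 1; ring
      _ ≤ |H v ω - ∫ ω', H v ω' ∂P| + |(∫ ω', H v ω' ∂P) - Γ v| := abs_add_le _ _
      _ ≤ _ := add_le_add (le_ciSup hbdd v) (hbounds v).2.2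
  have hsupm : Measurable fun ω => ⨆ v, |H v ω - ∫ ω', H v ω' ∂P| :=
    Measurable.iSup fun v => (hHm v).abs
  have hVnn : 0 ≤ (V n m : ℝ) ^ (4 / M) := by positivity
  calc eLpNorm (fun ω => ⨆ v, |H v ω - Γ v|) (ENNReal.ofReal (M / 2)) P
      ≤ eLpNorm ((fun ω => ⨆ v, |H v ω - ∫ ω', H v ω' ∂P|) + fun _ => β)
          (ENNReal.ofReal (M / 2)) P := eLpNorm_mono_real hpt
    _ ≤ ENNReal.ofReal ((V n m : ℝ) ^ (4 / M) * R) + ENNReal.ofReal β := by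
        refine (eLpNorm_add_le hsupm.aestronglyMeasurable aestronglyMeasurable_const hp1).trans
          (add_le_add hmax ?_)
        rw [eLpNorm_const _ (by positivity) (NeZero.ne P)]
        simp [Real.enorm_eq_ofReal hβ]
    _ = ENNReal.ofReal ((V n m : ℝ) ^ (4 / M) * R + β) :=
        (ENNReal.ofReal_add (by positivity) hβ).symm
    _ ≤ _ := by
        refine ENNReal.ofReal_le_ofReal ?_
        have hrate := HAC.one_div_le_biasRate (α := α) hBe
        have hS : 0 ≤ HAC.biasRate α (B n m) := le_trans (by positivity) hrate
        set T : ℝ := (V n m : ℝ) ^ (4 / M) * B n m ^ 3 / (κ n m : ℝ) with hT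
        have hT0 : 0 ≤ T := by positivity
        have e1 : (V n m : ℝ) ^ (4 / M) * R = D₁ * T := by
          simp only [hRdef, D₁, hT]; field_simp
        have e2 : β = D₂ * (1 / B n m) := by simp only [hβdef, D₂]; field_simp
        rw [e1, e2]
        have h1 : D₂ * (1 / B n m) ≤ D₂ * HAC.biasRate α (B n m) := by gcongr
        nlinarith [mul_nonneg hD₁ hS, mul_nonneg hD₂ hT0]
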